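/- Let $\Lambda\subset\mathbb{C}$ be a discrete subgroup (a lattice in the elliptic case; ranks $1$ and $0$ are the trigonometric and rational degenerations), with Weierstrass functions $$\sigma(w)=w\prod_{\omega\in\Lambda\setminus\{0\}}\Big(1-\frac{w}{\omega}\Big)e^{\frac{w}{\omega}+\frac{w^2}{2\omega^2}},\qquad \zeta(w)=\frac1w+\sum_{\omega\in\Lambda\setminus\{0\}}\Big(\frac1{w-\omega}+\frac1\omega+\frac{w}{\omega^2}\Big).$$ Let $A,B\in\mathbb{C}^*$ and $z,z_0\in\mathbb{C}$ with $2z\notin\Lambda$ and $z_0+nz\notin\Lambda$ for all integers $n\ge 0$. Put $$x_n=AB^n\frac{\sigma(z_0+nz)}{\sigma(z)^{n^2}}\quad(n\in\mathbb{Z}),\qquad \alpha=\frac{\sigma(2z)^2}{\sigma(z)^8},\qquad \beta=-\frac{\sigma(3z)}{\sigma(z)^9},\qquad d_n=\frac{x_{n+1}x_{n-1}}{x_n^2}.$$ Then $(x_n)$ satisfies the Somos-4 recurrence $x_{n+4}x_n=\alpha x_{n+3}x_{n+1}+\beta x_{n+2}^2$ for all $n\in\mathbb{Z}$. Moreover,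 there are $u,f\in\mathbb{C}$ and a complex sequence $(v_n)_{n\ge0}$ such that $$v_n=-v_{n-1}+\frac{u}{d_n},\qquad d_{n+1}=-d_n-v_n^2-f\qquad(n\ge1),\tag{$*$}$$ and for every choice of $u,f,(v_n)$ satisfying $(*)$ with these $d_n$, the sequence $$y_n=-x_n\sum_{j=0}^{n-1}v_j,\qquad n\ge 0$$ (with $y_0=0$, an empty sum) has the following properties. 1. It is a shadow Somos-4 sequence: for all $n\ge0$, $$x_ny_{n+4}-\alpha x_{n+1}y_{n+3}-2\beta x_{n+2}y_{n+2}-\alpha x_{n+3}y_{n+1}+x_{n+4}y_n=0.$$ 2. The sequences $(x_n)_{n\ge0}$, $(nx_n)_{n\ge0}$, $(y_n)_{n\ge0}$ are linearly independent over $\mathbb{C}$. 3. Up to an overall sign and up to adding multiples of $x_n$ and $nx_n$, it is the third shadow solution $x_n\zeta(z_0+nz)$: there is $\varepsilon\in\{1,-1\}$ such that for all $n\ge0$ $$y_n=\varepsilon\,x_n\big(n\zeta(z)+\zeta(z_0)-\zeta(z_0+nz)\big).$$ -/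

import Mathlib

noncomputable section

namespace SomosShadow

/-- The Weierstrass sigma function of a discrete subgroup `Λ` of `ℂ`:
`σ(w) = w ∏_{ω ∈ Λ, ω ≠ 0} (1 - w/ω) exp(w/ω + w²/(2ω²))`.
Rank two is the elliptic case, with invariants `g₂ = 60 ∑ ω⁻⁴` and `g₃ = 140 ∑ ω⁻⁶`.
Ranks one and zero are the trigonometric and the rational limits, where `g₂³ = 27 g₃²`. -/
def sigma (Λ : Submodule ℤ ℂ) (w : ℂ) : ℂ :=
  w * ∏' ω : {ω : ℂ // ω ∈ Λ ∧ ω ≠ 0},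
    ((1 - w / (ω : ℂ)) * Complex.exp (w / (ω : ℂ) + w ^ 2 / (2 * (ω : ℂ) ^ 2)))

/-- The Weierstrass zeta function
`ζ(w) = 1/w + ∑_{ω ∈ Λ, ω ≠ 0} (1/(w - ω) + 1/ω + w/ω²)`, for `w ∉ Λ`. -/
def zeta (Λ : Submodule ℤ ℂ) (w : ℂ) : ℂ :=
  1 / w + ∑' ω : {ω : ℂ // ω ∈ Λ ∧ ω ≠ 0},
    (1 / (w - (ω : ℂ)) + 1 / (ω : ℂ) + w / (ω : ℂ) ^ 2)

/-- The sequence `x_n = A Bⁿ σ(z₀ + n z) / σ(z)^(n²)`. -/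
def somosSeq (Λ : Submodule ℤ ℂ) (A B z z₀ : ℂ) (n : ℤ) : ℂ :=
  A * B ^ n * sigma Λ (z₀ + n * z) / sigma Λ z ^ (n ^ 2)

/-- The coefficient `α = σ(2z)² / σ(z)⁸`. -/
def coeffAlpha (Λ : Submodule ℤ ℂ) (z : ℂ) : ℂ :=
  sigma Λ (2 * z) ^ 2 / sigma Λ z ^ 8

/-- The coefficient `β = -σ(3z) / σ(z)⁹`. -/
def coeffBeta (Λ : Submodule ℤ ℂ) (z : ℂ) : ℂ :=
  -(sigma Λ (3 * z) / sigma Λ z ^ 9)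

/-- The Somos-4 recurrence, at all integers `n`. -/
def IsSomos4 (α β : ℂ) (x : ℤ → ℂ) : Prop :=
  ∀ n : ℤ, x (n + 4) * x n = α * x (n + 3) * x (n + 1) + β * x (n + 2) ^ 2

/-- The Somos-4 shadow equation (the linearization of the Somos-4 recurrence at `x`) for the
sequence `y`, at the indices `n ≥ 0`. -/
def IsShadow (α β : ℂ) (x y : ℤ → ℂ) : Prop :=
  ∀ n : ℤ, 0 ≤ n →
    x n * y (n + 4) - α * x (n + 1) * y (n + 3) - 2 * β * x (n + 2) * y (n + 2)
      - α * x (n + 3) * y (n + 1) + x (n + 4) * y n = 0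

/-- The ratios `d_n = x_{n+1} x_{n-1} / x_n²`. -/
def ratio (x : ℤ → ℂ) (n : ℤ) : ℂ :=
  x (n + 1) * x (n - 1) / x n ^ 2

/-- `(v_0, d_1), (v_1, d_2), …` is a forward orbit of the map
`(v_{n-1}, d_n) ↦ (v_n, d_{n+1})`, `v_n = -v_{n-1} + u/d_n`, `d_{n+1} = -d_n - v_n² - f`. -/
def IsMapOrbit (u f : ℂ) (v d : ℤ → ℂ) : Prop :=
  ∀ n : ℤ, 1 ≤ n → v n = -v (n - 1) + u / d n ∧ d (n + 1) = -d n - v n ^ 2 - f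

/-- `y_n = -x_n ∑_{j=0}^{n-1} v_j` (used for `n ≥ 0`; the sum is empty for `n = 0`). -/
def thirdShadow (x v : ℤ → ℂ) (n : ℤ) : ℂ :=
  -x n * ∑ j ∈ Finset.Ico (0 : ℤ) n, v j

end SomosShadow

end

/-! Everything rests on the addition formula σ(a+b)σ(a-b) = (℘(b)-℘(a))σ(a)²σ(b)² with ℘ = -ζ'
(`sigma_add_mul_sigma_sub`). It is proved by rank: Liouville's theorem in rank two, Euler's sine
product in rank one, plain algebra in rank zero. All later arguments use the formula without regard
to rank.

Eliminating ℘ between three instances gives the three-term relation behind Somos-4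
(`sigma_three_term`). Its logarithmic derivative, which is the effect of moving `z₀`, shows that x_n
ζ(z₀+nz) is a shadow solution. The formula also gives d_n = ℘(z) - ℘(z₀+nz), and the addition laws
of ζ make v_n = ζ(z₀+(n+1)z) - ζ(z₀+nz) - ζ(z) an orbit with u = ℘'(z); its partial sums telescope
to the asserted closed form.

An arbitrary orbit over the same d is this one up to sign (`IsMapOrbit.eq_or_eq_neg`): the map lets
d determine u², and then u and d determine v. This needs u ≠ 0 and no three consecutive equal d_n.
The first is ℘'(z) ≠ 0; the second holds because ℘ takes equal values only at points equal up to
sign modulo Λ, while 2z ∉ Λ. The same two facts give linear independence. -/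

noncomputable section

open Filter Topology Complex

namespace SomosShadow

/-! ### Convergence, zeros and derivatives of σ and ζ for any discrete subgroup. -/

section Analytic

variable (Λ : Submodule ℤ ℂ) [DiscreteTopology Λ]

/-- For a discrete subgroup the ℤ-rank equals the real dimension of its span. The bound makes ∑
|ω|⁻³ converge and leaves only three cases for the addition formula. -/
theorem finrank_le_two : Module.finrank ℤ Λ ≤ 2 := by
  have hs : DiscreteTopology (Submodule.span ℤ (Λ : Set ℂ)) := by
    rw [Submodule.span_eq]; infer_instance
  have h := Real.finrank_eq_int_finrank_of_discrete hs
  rw [Set.finrank, Set.finrank, Submodule.span_eq] at h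
  rw [← h, ← Complex.finrank_real_complex]
  exact Submodule.finrank_le _

theorem isClosed_coe : IsClosed (Λ : Set ℂ) :=
  @AddSubgroup.isClosed_of_discrete _ _ _ _ _ Λ.toAddSubgroup
    (inferInstanceAs (DiscreteTopology Λ))

theorem countable_coe : (Λ : Set ℂ).Countable :=
  Set.countable_coe_iff.mp (TopologicalSpace.separableSpace_iff_countable.mp
    (inferInstanceAs (TopologicalSpace.SeparableSpace Λ)))

theorem summable_inv_norm_cube :
    Summable fun ω : {ω : ℂ // ω ∈ Λ ∧ ω ≠ 0} => (‖(ω : ℂ)‖ ^ 3)⁻¹ := by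
  have h := ZLattice.summable_norm_pow_inv Λ 3 (by have := finrank_le_two Λ; omega)
  have h2 := h.comp_injective (i := fun ω : {ω : ℂ // ω ∈ Λ ∧ ω ≠ 0} => (⟨ω.1, ω.2.1⟩ : Λ))
    (fun a b hab => Subtype.ext (congrArg (fun x : Λ => (x : ℂ)) hab))
  simpa [Function.comp_def] using h2

/-- All but finitely many nonzero elements of a discrete subgroup are large. -/
theorem eventually_le_norm (r : ℝ) :
    ∀ᶠ ω : {ω : ℂ // ω ∈ Λ ∧ ω ≠ 0} in cofinite, r ≤ ‖(ω : ℂ)‖ := by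
  have h := (summable_inv_norm_cube Λ).tendsto_cofinite_zero
  have hr : 0 < ((|r| + 1) ^ 3)⁻¹ := by positivity
  filter_upwards [h.eventually_lt_const hr] with ω hω
  have h0 : 0 < ‖(ω : ℂ)‖ := norm_pos_iff.mpr ω.2.2
  have h1 := lt_of_pow_lt_pow_left₀ 3 (norm_nonneg _) ((inv_lt_inv₀ (by positivity) (by positivity)).mp hω)
  have := le_abs_self r
  linarith

/-- The Weierstrass elementary factor of genus two is `1 + O(x³)`. -/
theorem norm_elementaryFactor_sub_one_le {x : ℂ} (hx : ‖x‖ ≤ 1) :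
    ‖(1 - x) * exp (x + x ^ 2 / 2) - 1‖ ≤ Real.exp 2 * ‖x‖ ^ 3 := by
  -- The derivative vanishes to second order at 0, so the mean value inequality gives a cubic bound;
  -- the constant comes from |y + y²/2| ≤ 2 on the unit disc.
  have hd : ∀ y ∈ Metric.closedBall (0 : ℂ) ‖x‖,
      HasDerivWithinAt (fun y : ℂ => (1 - y) * exp (y + y ^ 2 / 2))
        (-(y ^ 2 * exp (y + y ^ 2 / 2))) (Metric.closedBall (0 : ℂ) ‖x‖) y := by
    intro y _
    have h1 : HasDerivAt (fun y : ℂ => y + y ^ 2 / 2) (1 + y) y := by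
      have := (hasDerivAt_id y).add (((hasDerivAt_id y).pow 2).div_const 2)
      convert! this using 1
      simp
    have h2 := ((hasDerivAt_id y).const_sub 1).mul h1.cexp
    convert! h2.hasDerivWithinAt using 1
    simp; ring
  have hb : ∀ y ∈ Metric.closedBall (0 : ℂ) ‖x‖,
      ‖-(y ^ 2 * exp (y + y ^ 2 / 2))‖ ≤ ‖x‖ ^ 2 * Real.exp 2 := by
    intro y hy
    rw [mem_closedBall_zero_iff] at hy
    rw [norm_neg, norm_mul, norm_pow]
    gcongr
    rw [Complex.norm_exp]
    apply Real.exp_le_exp.mpr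
    refine (Complex.re_le_norm _).trans ((norm_add_le _ _).trans ?_)
    rw [norm_div, norm_pow, Complex.norm_ofNat]
    nlinarith [norm_nonneg y]
  have := (convex_closedBall (0 : ℂ) ‖x‖).norm_image_sub_le_of_norm_hasDerivWithin_le hd hb
    (Metric.mem_closedBall_self (norm_nonneg _)) (y := x) (by simp)
  simp at this
  linarith

/-- The factors of the sigma product. -/
def sigmaFactor (ω w : ℂ) : ℂ := (1 - w / ω) * exp (w / ω + w ^ 2 / (2 * ω ^ 2))

theorem differentiable_sigmaFactor (ω : ℂ) : Differentiable ℂ (sigmaFactor ω) := by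
  unfold sigmaFactor
  fun_prop

theorem norm_sigmaFactor_sub_one_le {r : ℝ} {ω w : ℂ} (hw : ‖w‖ ≤ r) (hω : r ≤ ‖ω‖) :
    ‖sigmaFactor ω w - 1‖ ≤ Real.exp 2 * r ^ 3 * (‖ω‖ ^ 3)⁻¹ := by
  have h := norm_elementaryFactor_sub_one_le (x := w / ω)
    (by rw [norm_div]; exact div_le_one_of_le₀ (hw.trans hω) (norm_nonneg _))
  have e : (w / ω) ^ 2 / 2 = w ^ 2 / (2 * ω ^ 2) := by
    rw [div_pow, div_div, mul_comm]
  rw [e] at h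
  refine h.trans ?_
  rw [norm_div, div_pow, mul_assoc, div_eq_mul_inv]
  gcongr

/-- The sigma function without its factor `w`. -/
def reducedSigma (w : ℂ) : ℂ := ∏' ω : {ω : ℂ // ω ∈ Λ ∧ ω ≠ 0}, sigmaFactor ω w

omit [DiscreteTopology Λ] in
theorem sigma_eq_mul (w : ℂ) : sigma Λ w = w * reducedSigma Λ w := rfl

theorem multipliableLocallyUniformlyOn_sigmaFactor (r : ℝ) :
    MultipliableLocallyUniformlyOn
      (fun (ω : {ω : ℂ // ω ∈ Λ ∧ ω ≠ 0}) w => sigmaFactor ω w) (Metric.ball 0 r) := by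
  have h := Summable.multipliableLocallyUniformlyOn_one_add
    (f := fun (ω : {ω : ℂ // ω ∈ Λ ∧ ω ≠ 0}) w => sigmaFactor ω w - 1)
    (Metric.isOpen_ball (x := (0 : ℂ)) (ε := r))
    ((summable_inv_norm_cube Λ).mul_left (Real.exp 2 * r ^ 3)) ?_ ?_
  · simpa using h
  · filter_upwards [eventually_le_norm Λ r] with ω hω w hw
    exact norm_sigmaFactor_sub_one_le (mem_ball_zero_iff.mp hw).le hω
  · intro ω
    exact ((differentiable_sigmaFactor ω).continuous.sub continuous_const).continuousOn

theorem summable_norm_sigmaFactor_sub_one (w : ℂ) :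
    Summable fun ω : {ω : ℂ // ω ∈ Λ ∧ ω ≠ 0} => ‖sigmaFactor ω w - 1‖ := by
  refine ((summable_inv_norm_cube Λ).mul_left (Real.exp 2 * ‖w‖ ^ 3)).of_norm_bounded_eventually ?_
  filter_upwards [eventually_le_norm Λ ‖w‖] with ω hω
  simpa using norm_sigmaFactor_sub_one_le le_rfl hω

theorem multipliable_sigmaFactor (w : ℂ) :
    Multipliable fun ω : {ω : ℂ // ω ∈ Λ ∧ ω ≠ 0} => sigmaFactor ω w := by
  simpa using multipliable_one_add_of_summable (summable_norm_sigmaFactor_sub_one Λ w)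

theorem differentiable_reducedSigma : Differentiable ℂ (reducedSigma Λ) := by
  intro w
  have h := (multipliableLocallyUniformlyOn_sigmaFactor Λ (‖w‖ + 1)).hasProdLocallyUniformlyOn
  have h2 : DifferentiableOn ℂ (reducedSigma Λ) (Metric.ball 0 (‖w‖ + 1)) :=
    h.differentiableOn (.of_forall fun s => .fun_finsetProd fun ω _ =>
      (differentiable_sigmaFactor ω).differentiableOn) Metric.isOpen_ball
  exact h2.differentiableAt (Metric.isOpen_ball.mem_nhds (by simp))

theorem differentiable_sigma : Differentiable ℂ (sigma Λ) :=
  differentiable_id.mul (differentiable_reducedSigma Λ)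

omit [DiscreteTopology Λ] in
theorem reducedSigma_zero : reducedSigma Λ 0 = 1 := by
  simp [reducedSigma, sigmaFactor]

omit [DiscreteTopology Λ] in
theorem sigma_zero : sigma Λ 0 = 0 := by simp [sigma]

theorem hasDerivAt_sigma_zero : HasDerivAt (sigma Λ) 1 0 := by
  have := (hasDerivAt_id (0 : ℂ)).mul (differentiable_reducedSigma Λ 0).hasDerivAt
  convert! this using 1
  simp [reducedSigma_zero]

theorem sigmaFactor_ne_zero {ω w : ℂ} (h0 : ω ≠ 0) (h : w ≠ ω) : sigmaFactor ω w ≠ 0 := by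
  refine mul_ne_zero ?_ (exp_ne_zero _)
  rw [sub_ne_zero, ne_eq, eq_comm, div_eq_one_iff_eq h0]
  exact h

/-- An absolutely convergent product without zero factors is nonzero. The hypothesis admits `w = 0`,
where σ itself vanishes. -/
theorem reducedSigma_ne_zero {w : ℂ} (h : w ∈ Λ → w = 0) : reducedSigma Λ w ≠ 0 := by
  have := tprod_one_add_ne_zero_of_summable (f := fun ω : {ω : ℂ // ω ∈ Λ ∧ ω ≠ 0} =>
    sigmaFactor ω w - 1) ?_ (summable_norm_sigmaFactor_sub_one Λ w)
  · simpa [reducedSigma] using this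
  · intro ω
    rw [add_sub_cancel]
    refine sigmaFactor_ne_zero ω.2.2 fun e => ?_
    exact ω.2.2 (e ▸ h (e ▸ ω.2.1))

theorem sigma_ne_zero {w : ℂ} (h : w ∉ Λ) : sigma Λ w ≠ 0 :=
  mul_ne_zero (fun e => h (e ▸ Λ.zero_mem)) (reducedSigma_ne_zero Λ fun h' => absurd h' h)

theorem mem_of_sigma_eq_zero {w : ℂ} (h : sigma Λ w = 0) : w ∈ Λ := by
  by_contra h'
  exact sigma_ne_zero Λ h' h

omit [DiscreteTopology Λ] in
theorem reducedSigma_neg (w : ℂ) : reducedSigma Λ (-w) = reducedSigma Λ w := by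
  let e : {ω : ℂ // ω ∈ Λ ∧ ω ≠ 0} ≃ {ω : ℂ // ω ∈ Λ ∧ ω ≠ 0} :=
    (Equiv.neg ℂ).subtypeEquiv fun ω => by simp
  rw [reducedSigma, reducedSigma, ← e.tprod_eq]
  refine tprod_congr fun ω => ?_
  simp [sigmaFactor, e]

omit [DiscreteTopology Λ] in
theorem sigma_neg (w : ℂ) : sigma Λ (-w) = -sigma Λ w := by
  rw [sigma_eq_mul, sigma_eq_mul, reducedSigma_neg, neg_mul]

theorem norm_zetaTerm_le {r : ℝ} {ω w : ℂ} (hw : ‖w‖ ≤ r) (hω : 2 * r ≤ ‖ω‖) :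
    ‖1 / (w - ω) + 1 / ω + w / ω ^ 2‖ ≤ 2 * r ^ 2 * (‖ω‖ ^ 3)⁻¹ := by
  -- The index 0 occurs in sums over a whole lattice; here it forces `w = 0`, and both sides are 0.
  rcases eq_or_ne ω 0 with rfl | h0
  · have : w = 0 := by
      have := norm_nonneg w
      simp at hω
      exact norm_eq_zero.mp (by linarith)
    simp [this]
  have hpos := norm_pos_iff.mpr h0
  have h2 : ‖ω‖ / 2 ≤ ‖w - ω‖ := by
    have := norm_sub_norm_le ω w
    rw [norm_sub_rev] at this
    linarith
  have h1 : w - ω ≠ 0 := norm_pos_iff.mp (by linarith)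
  have e : 1 / (w - ω) + 1 / ω + w / ω ^ 2 = w ^ 2 / ((w - ω) * ω ^ 2) := by
    field_simp; ring
  rw [e, norm_div, norm_mul, norm_pow, norm_pow]
  calc ‖w‖ ^ 2 / (‖w - ω‖ * ‖ω‖ ^ 2) ≤ r ^ 2 / (‖ω‖ / 2 * ‖ω‖ ^ 2) := by gcongr
    _ = 2 * r ^ 2 * (‖ω‖ ^ 3)⁻¹ := by field_simp

theorem summable_zetaTerm (w : ℂ) :
    Summable fun ω : {ω : ℂ // ω ∈ Λ ∧ ω ≠ 0} =>
      (1 / (w - (ω : ℂ)) + 1 / (ω : ℂ) + w / (ω : ℂ) ^ 2) := by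
  refine ((summable_inv_norm_cube Λ).mul_left (2 * ‖w‖ ^ 2)).of_norm_bounded_eventually ?_
  filter_upwards [eventually_le_norm Λ (2 * ‖w‖)] with ω hω
  exact norm_zetaTerm_le le_rfl hω

theorem logDeriv_sigmaFactor {ω w : ℂ} (h0 : ω ≠ 0) (h : w ≠ ω) :
    logDeriv (sigmaFactor ω) w = 1 / (w - ω) + 1 / ω + w / ω ^ 2 := by
  have h1 : HasDerivAt (fun w : ℂ => w / ω + w ^ 2 / (2 * ω ^ 2)) (1 / ω + w / ω ^ 2) w := by
    have := ((hasDerivAt_id w).div_const ω).add (((hasDerivAt_id w).pow 2).div_const (2 * ω ^ 2))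
    convert! this using 1
    simp; field_simp
  have h2 : HasDerivAt (sigmaFactor ω) _ w :=
    (((hasDerivAt_id w).div_const ω).const_sub 1).mul h1.cexp
  rw [logDeriv_apply, h2.deriv, sigmaFactor]
  have h3 : ω - w ≠ 0 := sub_ne_zero.mpr h.symm
  have h4 : w - ω ≠ 0 := sub_ne_zero.mpr h
  have h5 : 1 - w / ω ≠ 0 := by
    rw [sub_ne_zero, ne_eq, eq_comm, div_eq_one_iff_eq h0]; exact h
  have h6 := exp_ne_zero (w / ω + w ^ 2 / (2 * ω ^ 2))
  simp only [id]
  generalize exp (w / ω + w ^ 2 / (2 * ω ^ 2)) = E at *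
  field_simp
  ring

/-- Local uniform convergence allows the logarithmic derivative of the product to be taken factor by
factor, which produces the series of ζ. -/
theorem hasDerivAt_sigma {w : ℂ} (h : w ∉ Λ) :
    HasDerivAt (sigma Λ) (sigma Λ w * zeta Λ w) w := by
  have hw : w ≠ 0 := fun e => h (e ▸ Λ.zero_mem)
  have hne : ∀ ω : {ω : ℂ // ω ∈ Λ ∧ ω ≠ 0}, w ≠ ω := fun ω e => h (e ▸ ω.2.1)
  have hS := reducedSigma_ne_zero Λ fun h' => absurd h' h
  have h1 : logDeriv (reducedSigma Λ) w = zeta Λ w - 1 / w := by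
    have := logDeriv_tprod_eq_tsum (s := Metric.ball 0 (‖w‖ + 1)) Metric.isOpen_ball (x := w)
      (by simp) (f := fun (ω : {ω : ℂ // ω ∈ Λ ∧ ω ≠ 0}) w => sigmaFactor ω w)
      (fun ω => sigmaFactor_ne_zero ω.2.2 (hne ω))
      (fun ω => (differentiable_sigmaFactor ω).differentiableOn)
      ((summable_zetaTerm Λ w).congr fun ω => (logDeriv_sigmaFactor ω.2.2 (hne ω)).symm)
      (multipliableLocallyUniformlyOn_sigmaFactor Λ _) hS
    rw [zeta, add_sub_cancel_left]
    refine Eq.trans this (tsum_congr fun ω => logDeriv_sigmaFactor ω.2.2 (hne ω))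
  have h2 := (hasDerivAt_id w).mul (differentiable_reducedSigma Λ w).hasDerivAt
  rw [logDeriv_apply, div_eq_iff hS] at h1
  convert! h2 using 1
  rw [h1, sigma_eq_mul]
  simp only [id]
  field_simp
  ring

theorem zeta_eq_div {w : ℂ} (h : w ∉ Λ) : zeta Λ w = deriv (sigma Λ) w / sigma Λ w := by
  rw [(hasDerivAt_sigma Λ h).deriv, mul_div_cancel_left₀ _ (sigma_ne_zero Λ h)]

theorem differentiableOn_zeta : DifferentiableOn ℂ (zeta Λ) (Λ : Set ℂ)ᶜ := by
  refine DifferentiableOn.congr (f := fun w => deriv (sigma Λ) w / sigma Λ w) ?_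
    fun w hw => zeta_eq_div Λ hw
  refine DifferentiableOn.div ?_ (differentiable_sigma Λ).differentiableOn
    fun w hw => sigma_ne_zero Λ hw
  exact ((differentiable_sigma Λ).differentiableOn (s := Set.univ)).deriv isOpen_univ |>.mono
    (Set.subset_univ _)

theorem compl_mem_nhds {w : ℂ} (h : w ∉ Λ) : (Λ : Set ℂ)ᶜ ∈ 𝓝 w :=
  (isClosed_coe Λ).isOpen_compl.mem_nhds h

theorem hasDerivAt_zeta {w : ℂ} (h : w ∉ Λ) : HasDerivAt (zeta Λ) (deriv (zeta Λ) w) w :=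
  ((differentiableOn_zeta Λ).differentiableAt (compl_mem_nhds Λ h)).hasDerivAt

theorem hasDerivAt_deriv_zeta {w : ℂ} (h : w ∉ Λ) :
    HasDerivAt (deriv (zeta Λ)) (deriv (deriv (zeta Λ)) w) w :=
  (((differentiableOn_zeta Λ).deriv (isClosed_coe Λ).isOpen_compl).differentiableAt
    (compl_mem_nhds Λ h)).hasDerivAt

end Analytic

/-! ### Rank two: quasi-periodicity and the addition formula by Liouville's theorem. -/

section Elliptic

variable (L : PeriodPair)

open scoped PeriodPair

theorem hasSumLocallyUniformly_zetaTerm :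
    HasSumLocallyUniformly
      (fun (l : L.lattice) (w : ℂ) => 1 / (w - (l : ℂ)) + 1 / (l : ℂ) + w / (l : ℂ) ^ 2)
      (fun w => ∑' l : L.lattice, (1 / (w - (l : ℂ)) + 1 / (l : ℂ) + w / (l : ℂ) ^ 2)) := by
  refine L.hasSumLocallyUniformly_aux (u := fun r l => 2 * r ^ 2 * (‖l‖⁻¹ ^ 3)) _
    (fun _ _ => (ZLattice.summable_norm_pow_inv _ 3 (by simp)).mul_left _) fun r hr =>
    Filter.eventually_atTop.mpr ⟨2 * r, ?_⟩
  rintro _ h s hs l rfl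
  rw [inv_pow]
  exact norm_zetaTerm_le hs.le h

/-- Since `1 / 0 = 0`, the summand at `l = 0` is exactly the separate term `1 / w`. Summing over the
whole lattice matches the series of `L.weierstrassP`. -/
theorem zeta_lattice_eq_tsum (w : ℂ) :
    zeta L.lattice w =
      ∑' l : L.lattice, (1 / (w - (l : ℂ)) + 1 / (l : ℂ) + w / (l : ℂ) ^ 2) := by
  have hs : Summable fun l : L.lattice => 1 / (w - (l : ℂ)) + 1 / (l : ℂ) + w / (l : ℂ) ^ 2 :=
    (hasSumLocallyUniformly_zetaTerm L).hasSum.summable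
  rw [← hs.sum_add_tsum_subtype_compl {0}, zeta]
  congr 1
  · simp
  · let e : {ω : ℂ // ω ∈ L.lattice ∧ ω ≠ 0} ≃ {l : L.lattice // l ∉ ({0} : Finset L.lattice)} :=
      { toFun := fun ω => ⟨⟨ω.1, ω.2.1⟩, fun h => ω.2.2
          (congrArg Subtype.val (Finset.mem_singleton.mp h))⟩
        invFun := fun l => ⟨l.1.1, l.1.2, fun h => l.2 (Finset.mem_singleton.mpr (Subtype.ext h))⟩
        left_inv := fun _ => rfl
        right_inv := fun _ => rfl }
    exact e.tsum_eq
      (fun l : {l : L.lattice // l ∉ ({0} : Finset L.lattice)} =>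
        1 / (w - (l : ℂ)) + 1 / (l : ℂ) + w / (l : ℂ) ^ 2)

theorem deriv_zeta_lattice {w : ℂ} (h : w ∉ L.lattice) :
    deriv (zeta L.lattice) w = -L.weierstrassP w := by
  have ht : ∀ x ∈ (L.lattice : Set ℂ)ᶜ, ∀ l : L.lattice,
      HasDerivAt (fun w : ℂ => 1 / (w - (l : ℂ)) + 1 / (l : ℂ) + w / (l : ℂ) ^ 2)
        (-(1 / (x - l) ^ 2 - 1 / (l : ℂ) ^ 2)) x := by
    intro x hx l
    have h1 : x - l ≠ 0 := sub_ne_zero.mpr fun e => hx (e ▸ l.2)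
    have h2 := ((((hasDerivAt_id x).sub_const (l : ℂ)).inv h1).add_const (1 / (l : ℂ))).add
      ((hasDerivAt_id x).div_const ((l : ℂ) ^ 2))
    convert! h2 using 1
    · ext; simp
    · simp; ring
  have hD := (hasSumLocallyUniformly_zetaTerm L).tendstoLocallyUniformlyOn
    (s := (L.lattice : Set ℂ)ᶜ) |>.deriv
    (.of_forall fun s => .fun_sum fun l _ => fun x hx =>
      (ht x hx l).differentiableAt.differentiableWithinAt) L.isClosed_lattice.isOpen_compl
  have h1 := hD.tendsto_at (Set.mem_compl h)
  have h2 : Tendsto (fun s : Finset L.lattice => ∑ l ∈ s, -(1 / (w - l) ^ 2 - 1 / (l : ℂ) ^ 2))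
      atTop (𝓝 (-L.weierstrassP w)) := (L.hasSum_weierstrassP w).neg
  have h3 := tendsto_nhds_unique h1 (h2.congr fun s => ?_)
  · rw [← h3]
    exact congrArg (deriv · w) (funext (zeta_lattice_eq_tsum L))
  · exact (HasDerivAt.fun_sum fun l _ => ht w h l).deriv.symm

/-- ℘ is periodic, so ζ(w+l) - ζ(w) has derivative 0 off the lattice, and the complement of a
countable set in the plane is connected. -/
theorem exists_zeta_add (l : L.lattice) :
    ∃ η : ℂ, ∀ w ∉ L.lattice, zeta L.lattice (w + l) = zeta L.lattice w + η := by
  have hmem : ∀ {w : ℂ}, w ∉ L.lattice → w + l ∉ L.lattice := fun {w} hw h' =>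
    hw ((Submodule.add_mem_iff_left _ l.2).mp h')
  have hd : ∀ w ∈ (L.lattice : Set ℂ)ᶜ,
      HasDerivAt (fun w => zeta L.lattice (w + l) - zeta L.lattice w) 0 w := by
    intro w hw
    have h1 := (hasDerivAt_zeta L.lattice (hmem hw)).comp_add_const w (l : ℂ)
    have h2 := h1.sub (hasDerivAt_zeta L.lattice hw)
    rw [deriv_zeta_lattice L hw, deriv_zeta_lattice L (hmem hw), L.weierstrassP_add_coe,
      sub_self] at h2
    exact h2
  obtain ⟨η, hη⟩ := L.isClosed_lattice.isOpen_compl.exists_is_const_of_deriv_eq_zero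
    ((countable_coe L.lattice).isConnected_compl_of_one_lt_rank
      (by simp [Complex.rank_real_complex])).isPreconnected
    (fun w hw => (hd w hw).differentiableAt.differentiableWithinAt)
    (fun w hw => (hd w hw).deriv)
  exact ⟨η, fun w hw => by rw [← hη w hw]; ring⟩

theorem exists_sigma_add (l : L.lattice) :
    ∃ c η : ℂ, ∀ w, sigma L.lattice (w + l) = c * exp (η * w) * sigma L.lattice w := by
  obtain ⟨η, hη⟩ := exists_zeta_add L l
  have hmem : ∀ {w : ℂ}, w ∉ L.lattice → w + l ∉ L.lattice := fun {w} hw h' =>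
    hw ((Submodule.add_mem_iff_left _ l.2).mp h')
  have hd : ∀ w ∈ (L.lattice : Set ℂ)ᶜ,
      HasDerivAt (fun w => sigma L.lattice (w + l) * exp (-(η * w)) / sigma L.lattice w) 0 w := by
    intro w hw
    have h1 := (hasDerivAt_sigma L.lattice (hmem hw)).comp_add_const w (l : ℂ)
    have h2 : HasDerivAt (fun w : ℂ => -(η * w)) (-η) w := by
      simpa only [neg_mul, mul_one] using! (hasDerivAt_id w).const_mul (-η)
    have hne := sigma_ne_zero L.lattice hw
    have h3 := (h1.mul h2.cexp).div (hasDerivAt_sigma L.lattice hw) hne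
    convert! h3 using 1
    rw [hη w hw, eq_comm, div_eq_zero_iff]
    left
    simp only [Pi.mul_apply]
    ring
  obtain ⟨c, hc⟩ := L.isClosed_lattice.isOpen_compl.exists_is_const_of_deriv_eq_zero
    ((countable_coe L.lattice).isConnected_compl_of_one_lt_rank
      (by simp [Complex.rank_real_complex])).isPreconnected
    (fun w hw => (hd w hw).differentiableAt.differentiableWithinAt)
    (fun w hw => (hd w hw).deriv)
  refine ⟨c, η, ?_⟩
  -- The identity off the lattice extends to all `w`, since both sides are continuous and the
  -- complement is dense.
  have hcont : Continuous (sigma L.lattice) := (differentiable_sigma L.lattice).continuous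
  have h1 : Continuous fun w => sigma L.lattice (w + l) := by fun_prop
  have h2 : Continuous fun w => c * exp (η * w) * sigma L.lattice w := by fun_prop
  refine congrFun (Continuous.ext_on ((countable_coe L.lattice).dense_compl ℝ) h1 h2
    fun w hw => ?_)
  have := hc w hw
  rw [div_eq_iff (sigma_ne_zero L.lattice hw), exp_neg] at this
  field_simp [exp_ne_zero] at this ⊢
  rw [this]

/-- A function analytic and even near `0` that vanishes at `0` is divisible by `w²`. -/
theorem exists_analyticAt_eq_sq_mul {h : ℂ → ℂ} (ha : AnalyticAt ℂ h 0) (h0 : h 0 = 0)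
    (he : ∀ w, h (-w) = h w) :
    ∃ k : ℂ → ℂ, AnalyticAt ℂ k 0 ∧ ∀ᶠ w in 𝓝 0, h w = w ^ 2 * k w := by
  have hd : deriv h 0 = 0 := by
    have h1 := deriv_comp_neg h 0
    simp only [he, neg_zero] at h1
    linear_combination h1 / 2
  have h2 : (2 : ℕ) ≤ analyticOrderAt h 0 := by
    rw [natCast_le_analyticOrderAt_iff_iteratedDeriv_eq_zero ha]
    intro i hi
    interval_cases i
    · simpa using h0
    · simpa using hd
  obtain ⟨k, hk, hk'⟩ := (natCast_le_analyticOrderAt ha).mp h2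
  exact ⟨k, hk, by simpa using hk'⟩

/-- With `b` fixed, `g` is elliptic and its singularities at lattice points are removable, so it is
constant by Liouville; at `a = b` its first term vanishes. -/
theorem sigma_add_mul_sigma_sub_lattice {a b : ℂ} (ha : a ∉ L.lattice) (hb : b ∉ L.lattice) :
    sigma L.lattice (a + b) * sigma L.lattice (a - b) =
      (deriv (zeta L.lattice) a - deriv (zeta L.lattice) b) *
        sigma L.lattice a ^ 2 * sigma L.lattice b ^ 2 := by
  classical
  rw [deriv_zeta_lattice L ha, deriv_zeta_lattice L hb]
  have hσ := differentiable_sigma L.lattice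
  have hS := differentiable_reducedSigma L.lattice
  let g : ℂ → ℂ := fun a =>
    sigma L.lattice (a + b) * sigma L.lattice (a - b) / sigma L.lattice a ^ 2 +
      sigma L.lattice b ^ 2 * L.weierstrassP a
  -- This is a² g(a) with the poles at 0 cancelled by hand. It is even and vanishes at 0, hence
  -- divisible by a², so `g` has an analytic continuation `k` there.
  let h : ℂ → ℂ := fun a =>
    sigma L.lattice (a + b) * sigma L.lattice (a - b) / reducedSigma L.lattice a ^ 2 +
      sigma L.lattice b ^ 2 * (a ^ 2 * L.weierstrassPExcept 0 a + 1)
  have hS0 : reducedSigma L.lattice 0 ≠ 0 := by simp [reducedSigma_zero]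
  have hh : AnalyticAt ℂ h 0 := by
    have h1 : AnalyticAt ℂ (reducedSigma L.lattice) 0 := hS.analyticAt 0
    have h2 : AnalyticAt ℂ (fun a => sigma L.lattice (a + b)) 0 :=
      Differentiable.analyticAt (by fun_prop) 0
    have h3 : AnalyticAt ℂ (fun a => sigma L.lattice (a - b)) 0 :=
      Differentiable.analyticAt (by fun_prop) 0
    have h4 : AnalyticAt ℂ (L.weierstrassPExcept 0) 0 := L.analyticAt_weierstrassPExcept 0
    exact ((h2.mul h3).div (h1.pow 2) (pow_ne_zero 2 hS0)).add (by fun_prop)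
  obtain ⟨k, hk, hhk⟩ := exists_analyticAt_eq_sq_mul hh
    (by simp [h, reducedSigma_zero, sigma_neg]; ring) (by
      intro w
      simp only [h, reducedSigma_neg, L.weierstrassPExcept_neg, neg_zero, even_two.neg_pow]
      rw [show -w + b = -(w - b) by ring, show -w - b = -(w + b) by ring, sigma_neg, sigma_neg]
      ring)
  have hgk : ∀ᶠ w in 𝓝 0, w ∉ L.lattice → g w = k w := by
    filter_upwards [hhk] with w hw hwL
    have hw0 : w ≠ 0 := fun e => hwL (e ▸ L.lattice.zero_mem)
    have hSw := reducedSigma_ne_zero L.lattice fun h' => absurd h' hwL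
    have e1 : L.weierstrassPExcept 0 w = L.weierstrassP w - 1 / w ^ 2 := by
      have := L.weierstrassPExcept_add 0 w
      simp at this
      rw [← this]; simp
    have e2 : h w = w ^ 2 * g w := by
      simp only [h, g, e1, sigma_eq_mul L.lattice w]
      field_simp
      ring
    rw [e2] at hw
    exact mul_left_cancel₀ (pow_ne_zero 2 hw0) hw
  -- The singularity at 0 is filled with the value of `k`, and periodicity carries this to every
  -- lattice point.
  let G : ℂ → ℂ := fun w => if w ∈ L.lattice then k 0 else g w
  have hGper : ∀ (w : ℂ) (l : L.lattice), G (w + l) = G w := by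
    intro w l
    have hiff : w + l ∈ L.lattice ↔ w ∈ L.lattice := Submodule.add_mem_iff_left _ l.2
    by_cases hw : w ∈ L.lattice
    · simp [G, hw, hiff]
    · simp only [G, hw, hiff, if_false]
      obtain ⟨c, η, hc⟩ := exists_sigma_add L l
      have hne := sigma_ne_zero L.lattice (mt hiff.mp hw)
      simp only [g, L.weierstrassP_add_coe]
      congr 1
      rw [hc w] at hne ⊢
      rw [show w + l + b = w + b + l by ring, show w + l - b = w - b + l by ring, hc, hc]
      rw [div_eq_div_iff (pow_ne_zero 2 hne) (pow_ne_zero 2 (sigma_ne_zero L.lattice hw))]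
      have : exp (η * (w + b)) * exp (η * (w - b)) = exp (η * w) ^ 2 := by
        rw [← exp_add, ← exp_nat_mul]; congr 1; push_cast; ring
      linear_combination (c ^ 2 * sigma L.lattice (w + b) * sigma L.lattice (w - b) *
        sigma L.lattice w ^ 2) * this
  have hG0 : DifferentiableAt ℂ G 0 := by
    refine hk.differentiableAt.congr_of_eventuallyEq ?_
    filter_upwards [hgk, L.compl_lattice_sdiff_singleton_mem_nhds 0] with w hw hw'
    by_cases hwL : w ∈ L.lattice
    · have : w = 0 := by
        by_contra hne
        exact hw' ⟨hwL, hne⟩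
      simp [G, this]
    · simp [G, hwL, hw hwL]
  have hGd : Differentiable ℂ G := by
    intro x
    by_cases hx : x ∈ L.lattice
    · have h1 : DifferentiableAt ℂ (fun w => G (w - x)) x := by
        have : DifferentiableAt ℂ G (x - x) := by rwa [sub_self]
        exact DifferentiableAt.comp (f := fun w : ℂ => w - x) x this (by fun_prop)
      refine h1.congr_of_eventuallyEq (.of_forall fun w => ?_)
      have := hGper (w - x) ⟨x, hx⟩
      simpa using this
    · have h1 : DifferentiableAt ℂ L.weierstrassP x :=
        L.differentiableOn_weierstrassP.differentiableAt (L.isClosed_lattice.isOpen_compl.mem_nhds hx)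
      have h2 : DifferentiableAt ℂ g x :=
        .add (.div (by fun_prop) (by fun_prop) (pow_ne_zero 2 (sigma_ne_zero L.lattice hx)))
          (h1.const_mul _)
      refine h2.congr_of_eventuallyEq ?_
      filter_upwards [L.isClosed_lattice.isOpen_compl.mem_nhds hx] with w hw
      exact if_neg hw
  have hconst := hGd.apply_eq_apply_of_bounded
    (IsZLattice.isCompact_range_of_periodic L.lattice _ hGd.continuous
      fun z w hw => hGper z ⟨w, hw⟩).isBounded a b
  simp only [G, if_neg ha, if_neg hb, g, sub_self, sigma_zero, mul_zero, zero_div,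
    zero_add] at hconst
  have hne := sigma_ne_zero L.lattice ha
  field_simp at hconst
  linear_combination hconst

end Elliptic

/-! ### Rank one: reduction to the sine function. -/

section Trigonometric

theorem hasSum_div_succ_sq (x : ℂ) :
    HasSum (fun n : ℕ => x ^ 2 / ((n : ℂ) + 1) ^ 2) (x ^ 2 * (Real.pi ^ 2 / 6)) := by
  have h := (hasSum_nat_add_iff' 1).mpr hasSum_zeta_two
  have h2 := (Complex.hasSum_ofReal.mpr h).mul_left (x ^ 2)
  convert! h2 using 1
  · ext n; push_cast; ring
  · push_cast; simp

variable (Λ : Submodule ℤ ℂ) [DiscreteTopology Λ]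

/-- Pairing the factors of nω and -nω cancels the linear exponents and leaves Euler's product for
the sine; the quadratic exponents add up to (w/ω)² ∑ n⁻² = (w/ω)² π²/6. -/
theorem sigma_eq_sin {ω : ℂ} (h0 : ω ≠ 0) (hΛ : ∀ x, x ∈ Λ ↔ ∃ n : ℤ, n * ω = x) (w : ℂ) :
    sigma Λ w = ω / Real.pi * sin (Real.pi * (w / ω)) *
      exp ((w / ω) ^ 2 * (Real.pi ^ 2 / 6)) := by
  have hinj : Function.Injective fun n : ℤ => (n : ℂ) * ω := fun m n h =>
    Int.cast_injective (mul_right_cancel₀ h0 h)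
  let e : {n : ℤ // n ∈ ({0}ᶜ : Set ℤ)} ≃ {x : ℂ // x ∈ Λ ∧ x ≠ 0} :=
    Equiv.ofBijective (fun n => ⟨n.1 * ω, (hΛ _).mpr ⟨n.1, rfl⟩,
      mul_ne_zero (Int.cast_ne_zero.mpr n.2) h0⟩)
      ⟨fun m n h => Subtype.ext (hinj (congrArg Subtype.val h)), by
        rintro ⟨x, hx, hx0⟩
        obtain ⟨n, rfl⟩ := (hΛ x).mp hx
        exact ⟨⟨n, fun e => hx0 (by rw [Set.mem_singleton_iff.mp e]; simp)⟩, rfl⟩⟩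
  have h1 : HasProd (fun n : ℤ => sigmaFactor (n * ω) w) (reducedSigma Λ w) := by
    have h := e.hasProd_iff.mpr (multipliable_sigmaFactor Λ w).hasProd
    refine (hasProd_subtype_iff_of_mulSupport_subset (s := ({0}ᶜ : Set ℤ)) ?_).mp h
    intro n hn hn0
    rw [Set.mem_singleton_iff] at hn0
    exact hn (by simp [hn0, sigmaFactor])
  -- The pairing counts the index 0 twice, which is harmless because that factor is 1 under division
  -- by zero. The shift by one drops it from the partial products.
  have h2 := ((h1.nat_mul_neg.tendsto_prod_nat).comp (tendsto_add_atTop_nat 1)).const_mul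
    (Real.pi * (w / ω))
  have h3 := (tendsto_euler_sin_prod (w / ω)).mul
    ((continuous_exp.tendsto _).comp (hasSum_div_succ_sq (w / ω)).tendsto_sum_nat)
  have h4 := tendsto_nhds_unique h2 (h3.congr fun n => ?_)
  · have hpi : (Real.pi : ℂ) ≠ 0 := ofReal_ne_zero.mpr Real.pi_ne_zero
    simp only [sigmaFactor, Int.cast_zero, zero_mul, div_zero, sub_zero, ne_eq, OfNat.ofNat_ne_zero,
      not_false_eq_true, zero_pow, mul_zero, add_zero, exp_zero, mul_one] at h4
    rw [sigma_eq_mul, mul_assoc, ← h4]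
    field_simp
  · simp only [Function.comp_apply]
    rw [Finset.prod_range_succ', exp_sum, mul_assoc, ← Finset.prod_mul_distrib]
    congr 1
    have : sigmaFactor (((0 : ℕ) : ℤ) * ω) w * sigmaFactor ((-((0 : ℕ) : ℤ) : ℤ) * ω) w = 1 := by
      simp [sigmaFactor]
    rw [this, mul_one]
    refine Finset.prod_congr rfl fun j _ => ?_
    have hj : (j : ℂ) + 1 ≠ 0 := Nat.cast_add_one_ne_zero j
    simp only [sigmaFactor]
    push_cast
    rw [mul_mul_mul_comm, ← exp_add]
    congr 1
    · field_simp; ring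
    · congr 1; field_simp; ring

theorem deriv_zeta_rank_one {ω : ℂ} (h0 : ω ≠ 0) (hΛ : ∀ x, x ∈ Λ ↔ ∃ n : ℤ, n * ω = x)
    {w : ℂ} (h : w ∉ Λ) :
    sin (Real.pi * (w / ω)) ≠ 0 ∧ deriv (zeta Λ) w =
      Real.pi ^ 2 / ω ^ 2 * (1 / 3 - 1 / sin (Real.pi * (w / ω)) ^ 2) := by
  have hpi : (Real.pi : ℂ) ≠ 0 := ofReal_ne_zero.mpr Real.pi_ne_zero
  have hs : ∀ {w}, w ∉ Λ → sin (Real.pi * (w / ω)) ≠ 0 := by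
    intro w hw hs
    have := sigma_ne_zero Λ hw
    rw [sigma_eq_sin Λ h0 hΛ, hs] at this
    simp at this
  refine ⟨hs h, ?_⟩
  have hl : ∀ w, HasDerivAt (fun w : ℂ => Real.pi * (w / ω)) (Real.pi / ω) w := fun w => by
    simpa [mul_div_assoc] using! ((hasDerivAt_id w).div_const ω).const_mul (Real.pi : ℂ)
  have hz : ∀ w ∉ Λ, zeta Λ w = Real.pi / ω * (cos (Real.pi * (w / ω)) / sin (Real.pi * (w / ω))) +
      Real.pi ^ 2 / (3 * ω ^ 2) * w := by
    intro w hw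
    have h1 : HasDerivAt (fun w : ℂ => (w / ω) ^ 2 * (Real.pi ^ 2 / 6))
        (Real.pi ^ 2 / (3 * ω ^ 2) * w) w := by
      convert! (((hasDerivAt_id w).div_const ω).pow 2).mul_const ((Real.pi : ℂ) ^ 2 / 6) using 1
      simp; field_simp; ring
    have h2 := (((hl w).csin).const_mul (ω / Real.pi)).mul h1.cexp
    have h3 := h2.deriv
    have h4 : deriv (sigma Λ) w = _ := (congrArg (deriv · w) (funext (sigma_eq_sin Λ h0 hΛ))).trans h3
    rw [zeta_eq_div Λ hw, h4, sigma_eq_sin Λ h0 hΛ]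
    have := hs hw
    have h6 := exp_ne_zero ((w / ω) ^ 2 * (Real.pi ^ 2 / 6))
    generalize exp ((w / ω) ^ 2 * (Real.pi ^ 2 / 6)) = E at *
    generalize sin (Real.pi * (w / ω)) = S at *
    generalize cos (Real.pi * (w / ω)) = C at *
    field_simp
  have h1 := (((hl w).ccos).div ((hl w).csin) (hs h)).const_mul (Real.pi / ω : ℂ)
  have h2 := h1.add ((hasDerivAt_id w).const_mul ((Real.pi : ℂ) ^ 2 / (3 * ω ^ 2)))
  have h3 := h2.congr_of_eventuallyEq (f₁ := zeta Λ)
    (by filter_upwards [compl_mem_nhds Λ h] with x hx using hz x hx)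
  rw [h3.deriv]
  have := hs h
  have hsc := sin_sq_add_cos_sq (Real.pi * (w / ω))
  generalize sin (Real.pi * (w / ω)) = S at *
  generalize cos (Real.pi * (w / ω)) = C at *
  field_simp
  linear_combination (-3) * hsc

/-- The sines satisfy sin(s+t) sin(s-t) = sin² s - sin² t, and the exponentials agree because (a+b)²
+ (a-b)² = 2a² + 2b². -/
theorem sigma_add_mul_sigma_sub_rank_one {ω : ℂ} (h0 : ω ≠ 0)
    (hΛ : ∀ x, x ∈ Λ ↔ ∃ n : ℤ, n * ω = x) {a b : ℂ} (ha : a ∉ Λ) (hb : b ∉ Λ) :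
    sigma Λ (a + b) * sigma Λ (a - b) =
      (deriv (zeta Λ) a - deriv (zeta Λ) b) * sigma Λ a ^ 2 * sigma Λ b ^ 2 := by
  have hpi : (Real.pi : ℂ) ≠ 0 := ofReal_ne_zero.mpr Real.pi_ne_zero
  obtain ⟨hsa, hda⟩ := deriv_zeta_rank_one Λ h0 hΛ ha
  obtain ⟨hsb, hdb⟩ := deriv_zeta_rank_one Λ h0 hΛ hb
  rw [hda, hdb]
  simp only [sigma_eq_sin Λ h0 hΛ]
  have e1 : exp (((a + b) / ω) ^ 2 * (Real.pi ^ 2 / 6)) * exp (((a - b) / ω) ^ 2 * (Real.pi ^ 2 / 6))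
      = exp ((a / ω) ^ 2 * (Real.pi ^ 2 / 6)) ^ 2 * exp ((b / ω) ^ 2 * (Real.pi ^ 2 / 6)) ^ 2 := by
    simp only [← exp_add, ← exp_nat_mul]
    congr 1; push_cast; ring
  have e2 : sin (Real.pi * ((a + b) / ω)) * sin (Real.pi * ((a - b) / ω)) =
      sin (Real.pi * (a / ω)) ^ 2 - sin (Real.pi * (b / ω)) ^ 2 := by
    rw [add_div, sub_div, mul_add, mul_sub, sin_add, sin_sub]
    linear_combination (sin (Real.pi * (a / ω)) ^ 2) * sin_sq_add_cos_sq (Real.pi * (b / ω)) -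
      (sin (Real.pi * (b / ω)) ^ 2) * sin_sq_add_cos_sq (Real.pi * (a / ω))
  calc _ = (ω / Real.pi) ^ 2 * (sin (Real.pi * ((a + b) / ω)) * sin (Real.pi * ((a - b) / ω))) *
        (exp (((a + b) / ω) ^ 2 * (Real.pi ^ 2 / 6)) *
          exp (((a - b) / ω) ^ 2 * (Real.pi ^ 2 / 6))) := by ring
    _ = _ := by
        rw [e1, e2]
        generalize sin (Real.pi * (a / ω)) = S at *
        generalize sin (Real.pi * (b / ω)) = T at *
        field_simp
        ring

end Trigonometric

/-! ### Rank zero: σ(w) = w and ζ(w) = 1/w. -/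

section Rational

theorem sigma_add_mul_sigma_sub_bot {a b : ℂ} (ha : a ≠ 0) (hb : b ≠ 0) :
    sigma ⊥ (a + b) * sigma ⊥ (a - b) =
      (deriv (zeta ⊥) a - deriv (zeta ⊥) b) * sigma ⊥ a ^ 2 * sigma ⊥ b ^ 2 := by
  have : IsEmpty {ω : ℂ // ω ∈ (⊥ : Submodule ℤ ℂ) ∧ ω ≠ 0} :=
    ⟨fun ω => ω.2.2 ((Submodule.mem_bot ℤ).mp ω.2.1)⟩
  have hs : ∀ w, sigma ⊥ w = w := fun w => by simp [sigma]
  have hz : zeta ⊥ = fun w => w⁻¹ := by ext w; simp [zeta]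
  have hd : ∀ w, deriv (zeta ⊥) w = -(w ^ 2)⁻¹ := fun w => by rw [hz, deriv_inv]
  rw [hs, hs, hs, hs, hd, hd]
  field_simp
  ring

end Rational

/-! ### The addition formula in all ranks. -/

section Addition

variable (Λ : Submodule ℤ ℂ) [DiscreteTopology Λ]

theorem discrete_cases : Λ = ⊥ ∨ (∃ ω : ℂ, ω ≠ 0 ∧ ∀ x, x ∈ Λ ↔ ∃ n : ℤ, n * ω = x) ∨
    ∃ L : PeriodPair, Λ = L.lattice := by
  have hr := finrank_le_two Λ
  have b := Module.finBasis ℤ Λ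
  generalize hn : Module.finrank ℤ Λ = n at *
  have hmem : Submodule.span ℤ (Set.range fun i => (b i : ℂ)) = Λ := by
    have h1 := congrArg (Submodule.map Λ.subtype) b.span_eq
    rw [Submodule.map_span, ← Set.range_comp, Submodule.map_top, Submodule.range_subtype] at h1
    exact h1
  interval_cases n
  · left
    rw [← hmem]
    simp
  · right; left
    refine ⟨b 0, fun h => b.ne_zero 0 (Subtype.ext h), fun x => ?_⟩
    rw [Set.range_unique] at hmem
    conv_lhs => rw [← hmem]
    rw [Submodule.mem_span_singleton]
    simp [Fin.default_eq_zero]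
  · right; right
    have hdis : DiscreteTopology (Submodule.span ℤ (Set.range fun i => (b i : ℂ))) := by
      rw [hmem]; infer_instance
    -- Discreteness upgrades independence over ℤ to independence over ℝ, as a `PeriodPair` requires.
    have hind : LinearIndependent ℝ fun i => (b i : ℂ) := by
      rw [linearIndependent_iff_card_eq_finrank_span, Real.finrank_eq_int_finrank_of_discrete hdis,
        Set.finrank, hmem, hn]
      simp
    have he : (fun i => (b i : ℂ)) = ![(b 0 : ℂ), (b 1 : ℂ)] := by
      ext i; fin_cases i <;> rfl
    rw [he] at hind hmem
    refine ⟨⟨b 0, b 1, hind⟩, ?_⟩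
    refine hmem.symm.trans (congrArg (Submodule.span ℤ) ?_)
    simp [Set.pair_comm]

/-- The addition formula of the sigma function; here `-deriv (zeta Λ)` is Weierstrass's `℘`. -/
theorem sigma_add_mul_sigma_sub {a b : ℂ} (ha : a ∉ Λ) (hb : b ∉ Λ) :
    sigma Λ (a + b) * sigma Λ (a - b) =
      (deriv (zeta Λ) a - deriv (zeta Λ) b) * sigma Λ a ^ 2 * sigma Λ b ^ 2 := by
  rcases discrete_cases Λ with rfl | ⟨ω, h0, hΛ⟩ | ⟨L, rfl⟩
  · exact sigma_add_mul_sigma_sub_bot (by simpa using ha) (by simpa using hb)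
  · exact sigma_add_mul_sigma_sub_rank_one Λ h0 hΛ ha hb
  · exact sigma_add_mul_sigma_sub_lattice L ha hb

end Addition

/-! ### Identities for σ, ζ and ζ' derived from the addition formula. -/

section Consequences

variable (Λ : Submodule ℤ ℂ) [DiscreteTopology Λ]

theorem hasDerivAt_sigma_add {a b : ℂ} (h : a + b ∉ Λ) :
    HasDerivAt (fun w => sigma Λ (w + b)) (sigma Λ (a + b) * zeta Λ (a + b)) a :=
  (hasDerivAt_sigma Λ h).comp_add_const a b

theorem hasDerivAt_sigma_sub {a b : ℂ} (h : a - b ∉ Λ) :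
    HasDerivAt (fun w => sigma Λ (w - b)) (sigma Λ (a - b) * zeta Λ (a - b)) a :=
  (hasDerivAt_sigma Λ h).comp_sub_const a b

omit [DiscreteTopology Λ] in
theorem zeta_neg (w : ℂ) : zeta Λ (-w) = -zeta Λ w := by
  let e : {ω : ℂ // ω ∈ Λ ∧ ω ≠ 0} ≃ {ω : ℂ // ω ∈ Λ ∧ ω ≠ 0} :=
    (Equiv.neg ℂ).subtypeEquiv fun ω => by simp
  rw [zeta, zeta, ← e.tsum_eq, neg_add, ← tsum_neg]
  congr 1
  · rw [div_neg]
  refine tsum_congr fun ω => ?_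
  have h1 : -w - -(ω : ℂ) = -(w - ω) := by ring
  simp only [e, Equiv.subtypeEquiv_apply, Equiv.neg_apply, h1, div_neg, neg_sq]
  ring

theorem hasDerivAt_sigma_add_mul_sigma_sub {a b : ℂ} (ha : a ∉ Λ) (hb : b ∉ Λ) :
    HasDerivAt (fun w => sigma Λ (w + b) * sigma Λ (w - b))
      (deriv (deriv (zeta Λ)) a * sigma Λ a ^ 2 * sigma Λ b ^ 2 +
        2 * zeta Λ a * (sigma Λ (a + b) * sigma Λ (a - b))) a := by
  have h1 := (((hasDerivAt_deriv_zeta Λ ha).sub_const (deriv (zeta Λ) b)).mul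
    ((hasDerivAt_sigma Λ ha).pow 2)).mul_const (sigma Λ b ^ 2)
  have h2 := h1.congr_of_eventuallyEq (f₁ := fun w => sigma Λ (w + b) * sigma Λ (w - b))
    (by filter_upwards [compl_mem_nhds Λ ha] with w hw using sigma_add_mul_sigma_sub Λ hw hb)
  convert! h2 using 1
  rw [sigma_add_mul_sigma_sub Λ ha hb]
  simp
  ring

/-- This is the logarithmic derivative of the addition formula in `a`, cleared of denominators. -/
theorem zeta_add_add_zeta_sub {a b : ℂ} (ha : a ∉ Λ) (hb : b ∉ Λ) (hab : a + b ∉ Λ)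
    (hab' : a - b ∉ Λ) :
    (zeta Λ (a + b) + zeta Λ (a - b) - 2 * zeta Λ a) *
      (deriv (zeta Λ) a - deriv (zeta Λ) b) = deriv (deriv (zeta Λ)) a := by
  have h1 := ((hasDerivAt_sigma_add Λ hab).mul (hasDerivAt_sigma_sub Λ hab')).unique
    (hasDerivAt_sigma_add_mul_sigma_sub Λ ha hb)
  have h2 := sigma_add_mul_sigma_sub Λ ha hb
  have ha' := pow_ne_zero 2 (sigma_ne_zero Λ ha)
  have hb' := pow_ne_zero 2 (sigma_ne_zero Λ hb)
  apply mul_right_cancel₀ (mul_ne_zero ha' hb')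
  linear_combination h1 - (zeta Λ (a + b) + zeta Λ (a - b) - 2 * zeta Λ a) * h2

/-- Differentiating the addition formula in its first variable and putting `b = a`, only the
derivative of σ(w-a) survives on the left, and it equals 1. -/
theorem deriv_deriv_zeta {a : ℂ} (ha : a ∉ Λ) :
    deriv (deriv (zeta Λ)) a * sigma Λ a ^ 4 = sigma Λ (2 * a) := by
  have h1 : HasDerivAt (fun w => sigma Λ (w - a)) 1 a := by
    have : HasDerivAt (sigma Λ) 1 (a - a) := by rw [sub_self]; exact hasDerivAt_sigma_zero Λ
    exact this.comp_sub_const a a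
  have h2 := ((differentiable_sigma Λ (a + a)).hasDerivAt.comp_add_const a a).mul h1
  have h3 := h2.unique (hasDerivAt_sigma_add_mul_sigma_sub Λ ha ha)
  rw [two_mul]
  rw [sub_self, sigma_zero] at h3
  linear_combination -h3

theorem deriv_deriv_zeta_ne_zero {a : ℂ} (ha : 2 * a ∉ Λ) : deriv (deriv (zeta Λ)) a ≠ 0 := by
  have ha' : a ∉ Λ := fun h => ha (by rw [two_mul]; exact Λ.add_mem h h)
  intro h
  have := deriv_deriv_zeta Λ ha'
  rw [h, zero_mul] at this
  exact sigma_ne_zero Λ ha this.symm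

/-- The values of `℘` at two points agree only if the points agree up to sign and periods. -/
theorem mem_of_deriv_zeta_eq {a b : ℂ} (ha : a ∉ Λ) (hb : b ∉ Λ)
    (h : deriv (zeta Λ) a = deriv (zeta Λ) b) : a + b ∈ Λ ∨ a - b ∈ Λ := by
  have := sigma_add_mul_sigma_sub Λ ha hb
  rw [h, sub_self, zero_mul, zero_mul, mul_eq_zero] at this
  exact this.imp (mem_of_sigma_eq_zero Λ) (mem_of_sigma_eq_zero Λ)

/-- The addition formulas for (w, 2z), (w, z) and (2z, z) involve the differences of three values of
℘, which are linearly dependent. Density removes the restriction w ∉ Λ. -/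
theorem sigma_three_term {z : ℂ} (hz : 2 * z ∉ Λ) (w : ℂ) :
    sigma Λ (w + 2 * z) * sigma Λ (w - 2 * z) * sigma Λ z ^ 2 =
      sigma Λ (2 * z) ^ 2 * (sigma Λ (w + z) * sigma Λ (w - z)) -
        sigma Λ (3 * z) * sigma Λ z * sigma Λ w ^ 2 := by
  have hz' : z ∉ Λ := fun h => hz (by rw [two_mul]; exact Λ.add_mem h h)
  have hcont : Continuous (sigma Λ) := (differentiable_sigma Λ).continuous
  have h1 : Continuous fun w => sigma Λ (w + 2 * z) * sigma Λ (w - 2 * z) * sigma Λ z ^ 2 := by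
    fun_prop
  have h2 : Continuous fun w => sigma Λ (2 * z) ^ 2 * (sigma Λ (w + z) * sigma Λ (w - z)) -
        sigma Λ (3 * z) * sigma Λ z * sigma Λ w ^ 2 := by fun_prop
  refine congrFun (Continuous.ext_on ((countable_coe Λ).dense_compl ℝ) h1 h2
    fun w hw => ?_) w
  have e1 := sigma_add_mul_sigma_sub Λ hw hz
  have e2 := sigma_add_mul_sigma_sub Λ hw hz'
  have e3 := sigma_add_mul_sigma_sub Λ hz hz'
  rw [show 2 * z + z = 3 * z by ring, show 2 * z - z = z by ring] at e3
  linear_combination sigma Λ z ^ 2 * e1 - sigma Λ (2 * z) ^ 2 * e2 + sigma Λ w ^ 2 * e3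

/-- The logarithmic derivative of `sigma_three_term` in `w`. -/
theorem sigma_three_term_deriv {z w : ℂ} (hz : 2 * z ∉ Λ) (h0 : w ∉ Λ) (h1 : w + z ∉ Λ)
    (h2 : w - z ∉ Λ) (h3 : w + 2 * z ∉ Λ) (h4 : w - 2 * z ∉ Λ) :
    sigma Λ (w + 2 * z) * sigma Λ (w - 2 * z) * sigma Λ z ^ 2 *
        (zeta Λ (w + 2 * z) + zeta Λ (w - 2 * z)) =
      sigma Λ (2 * z) ^ 2 * (sigma Λ (w + z) * sigma Λ (w - z)) *
        (zeta Λ (w + z) + zeta Λ (w - z)) -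
        sigma Λ (3 * z) * sigma Λ z * sigma Λ w ^ 2 * (2 * zeta Λ w) := by
  have e1 := ((hasDerivAt_sigma_add Λ h3).mul (hasDerivAt_sigma_sub Λ h4)).mul_const
    (sigma Λ z ^ 2)
  have e2 := (((hasDerivAt_sigma_add Λ h1).mul (hasDerivAt_sigma_sub Λ h2)).const_mul
    (sigma Λ (2 * z) ^ 2)).sub
      (((hasDerivAt_sigma Λ h0).pow 2).const_mul (sigma Λ (3 * z) * sigma Λ z))
  have e3 := e1.unique (e2.congr_of_eventuallyEq (.of_forall fun w => sigma_three_term Λ hz w))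
  simp at e3
  linear_combination e3

/-- The addition formula of `ζ`, cleared of denominators. -/
theorem zeta_add_formula {w z : ℂ} (hz : z ∉ Λ) (hw : w ∉ Λ) (hwz : w + z ∉ Λ) :
    2 * (zeta Λ (w + z) - zeta Λ w - zeta Λ z) * (deriv (zeta Λ) (w + z) - deriv (zeta Λ) w) +
      deriv (deriv (zeta Λ)) (w + z) + deriv (deriv (zeta Λ)) w = 0 := by
  have hc1 := (hasDerivAt_zeta Λ hw).continuousAt
  have hc2 := (hasDerivAt_deriv_zeta Λ hw).continuousAt
  have hadd : ContinuousAt (fun w => w + z) w := by fun_prop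
  have hc3 : ContinuousAt (fun w => zeta Λ (w + z)) w :=
    ContinuousAt.comp (f := fun w => w + z) (hasDerivAt_zeta Λ hwz).continuousAt hadd
  have hc4 : ContinuousAt (fun w => deriv (zeta Λ) (w + z)) w :=
    ContinuousAt.comp (f := fun w => w + z) (hasDerivAt_deriv_zeta Λ hwz).continuousAt hadd
  have hdd : DifferentiableOn ℂ (deriv (deriv (zeta Λ))) (Λ : Set ℂ)ᶜ :=
    ((differentiableOn_zeta Λ).deriv (isClosed_coe Λ).isOpen_compl).deriv
      (isClosed_coe Λ).isOpen_compl
  have hc5 := (hdd.differentiableAt (compl_mem_nhds Λ hw)).continuousAt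
  have hc6 : ContinuousAt (fun w => deriv (deriv (zeta Λ)) (w + z)) w :=
    ContinuousAt.comp (f := fun w => w + z)
      (hdd.differentiableAt (compl_mem_nhds Λ hwz)).continuousAt hadd
  have hcont : ContinuousAt (fun w => 2 * (zeta Λ (w + z) - zeta Λ w - zeta Λ z) *
      (deriv (zeta Λ) (w + z) - deriv (zeta Λ) w) + deriv (deriv (zeta Λ)) (w + z) +
      deriv (deriv (zeta Λ)) w) w := by fun_prop
  have hinj : Function.Injective fun w : ℂ => 2 * w + z := fun a b h =>
    mul_left_cancel₀ two_ne_zero (add_right_cancel h)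
  -- The identity comes from `zeta_add_add_zeta_sub` at (x+z, x) and at (x, x+z), where ζ(2x+z)
  -- cancels. This needs 2x+z ∉ Λ, a condition then removed by continuity.
  have hdense : Dense ((fun w : ℂ => 2 * w + z) ⁻¹' (Λ : Set ℂ))ᶜ :=
    ((countable_coe Λ).preimage hinj).dense_compl ℝ
  refine tendsto_nhds_unique_of_frequently_eq hcont tendsto_const_nhds ?_
  refine ((mem_closure_iff_frequently.mp (hdense w)).and_eventually
    (Filter.Eventually.and (compl_mem_nhds Λ hw) (hadd.eventually (compl_mem_nhds Λ hwz)))).mono ?_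
  rintro x ⟨hx2, hx, hxz⟩
  have hx2' : x + z + x ∉ Λ := by
    rw [show x + z + x = 2 * x + z by ring]; exact hx2
  have e1 := zeta_add_add_zeta_sub Λ hxz hx hx2' (by simpa using hz)
  have e2 := zeta_add_add_zeta_sub Λ hx hxz (by rwa [add_comm]) (by
    rw [sub_add_cancel_left]; exact mt Λ.neg_mem_iff.mp hz)
  rw [add_sub_cancel_left] at e1
  rw [sub_add_cancel_left, zeta_neg, add_comm x (x + z)] at e2
  linear_combination -e1 - e2

/-- The square of `ζ(w + z) - ζ(w) - ζ(z)` is `℘(w + z) + ℘(w)` up to a constant. -/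
theorem exists_zeta_sq {z : ℂ} (hz : z ∉ Λ) :
    ∃ C : ℂ, ∀ w, w ∉ Λ → w + z ∉ Λ →
      (zeta Λ (w + z) - zeta Λ w - zeta Λ z) ^ 2 =
        C - deriv (zeta Λ) (w + z) - deriv (zeta Λ) w := by
  have hopen : IsOpen {w : ℂ | w ∉ Λ ∧ w + z ∉ Λ} :=
    (isClosed_coe Λ).isOpen_compl.inter
      ((isClosed_coe Λ).isOpen_compl.preimage (f := fun w => w + z) (by fun_prop))
  have hconn : IsPreconnected {w : ℂ | w ∉ Λ ∧ w + z ∉ Λ} := by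
    have hc : ((Λ : Set ℂ) ∪ (fun w => w + z) ⁻¹' (Λ : Set ℂ)).Countable :=
      (countable_coe Λ).union ((countable_coe Λ).preimage (add_left_injective z))
    have := (hc.isConnected_compl_of_one_lt_rank (by simp [Complex.rank_real_complex])).isPreconnected
    rwa [Set.compl_union] at this
  -- The derivative is the left side of `zeta_add_formula`; the constant `C` exists because the
  -- domain is connected.
  have hd : ∀ w ∈ {w : ℂ | w ∉ Λ ∧ w + z ∉ Λ},
      HasDerivAt (fun w => (zeta Λ (w + z) - zeta Λ w - zeta Λ z) ^ 2 +
        deriv (zeta Λ) (w + z) + deriv (zeta Λ) w) 0 w := by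
    rintro w ⟨hw, hwz⟩
    have h1 := ((((hasDerivAt_zeta Λ hwz).comp_add_const w z).sub
      (hasDerivAt_zeta Λ hw)).sub_const (zeta Λ z)).pow 2
    have h2 := (h1.add ((hasDerivAt_deriv_zeta Λ hwz).comp_add_const w z)).add
      (hasDerivAt_deriv_zeta Λ hw)
    convert! h2 using 1
    simp
    linear_combination -zeta_add_formula Λ hz hw hwz
  obtain ⟨C, hC⟩ := hopen.exists_is_const_of_deriv_eq_zero hconn
    (fun w hw => (hd w hw).differentiableAt.differentiableWithinAt) (fun w hw => (hd w hw).deriv)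
  exact ⟨C, fun w hw hwz => by rw [← hC w ⟨hw, hwz⟩]; ring⟩

end Consequences

/-! ### Algebra of the map: rigidity of orbits and linear independence. -/

section Orbits

variable {d : ℤ → ℂ}

theorem IsMapOrbit.mul_add {u f : ℂ} {v : ℤ → ℂ} (h : IsMapOrbit u f v d)
    (hd : ∀ n : ℤ, 1 ≤ n → d n ≠ 0) {n : ℤ} (hn : 1 ≤ n) : d n * (v n + v (n - 1)) = u := by
  rw [(h n hn).1]
  field_simp [hd n hn]
  ring

/-- Subtracting consecutive second equations eliminates f: v_n² - v_{n-1}² = d_{n-1} - d_{n+1}. With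
the known sum v_n + v_{n-1} this isolates each of the two terms. The equation at n-1 is used, hence
`2 ≤ n`. -/
theorem IsMapOrbit.two_mul_mul {u f : ℂ} {v : ℤ → ℂ} (h : IsMapOrbit u f v d)
    (hd : ∀ n : ℤ, 1 ≤ n → d n ≠ 0) {n : ℤ} (hn : 2 ≤ n) :
    2 * u * d n * v n = u ^ 2 + d n ^ 2 * (d (n - 1) - d (n + 1)) ∧
      2 * u * d n * v (n - 1) = u ^ 2 - d n ^ 2 * (d (n - 1) - d (n + 1)) := by
  have h1 := h.mul_add hd (n := n) (by omega)
  have h2 := (h n (by omega)).2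
  have h3 := (h (n - 1) (by omega)).2
  rw [sub_add_cancel] at h3
  constructor
  · linear_combination (u - d n * (v n - v (n - 1))) * h1 + d n ^ 2 * (h2 - h3)
  · linear_combination (u + d n * (v n - v (n - 1))) * h1 - d n ^ 2 * (h2 - h3)

/-- The expressions for v_n obtained at the indices n and n+1 must agree. So d alone determines u²
as soon as d_{n+1} ≠ d_n. -/
theorem IsMapOrbit.sq_mul {u f : ℂ} {v : ℤ → ℂ} (h : IsMapOrbit u f v d)
    (hd : ∀ n : ℤ, 1 ≤ n → d n ≠ 0) {n : ℤ} (hn : 2 ≤ n) :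
    u ^ 2 * (d (n + 1) - d n) = -d n * d (n + 1) *
      (d (n + 1) * (d n - d (n + 2)) + d n * (d (n - 1) - d (n + 1))) := by
  have h1 := (h.two_mul_mul hd hn).1
  have h2 := (h.two_mul_mul hd (n := n + 1) (by omega)).2
  rw [add_sub_cancel_right, show n + 1 + 1 = n + 2 by ring] at h2
  linear_combination d n * h2 - d (n + 1) * h1

/-- Two orbits over the same sequence `d` agree up to sign. -/
theorem IsMapOrbit.eq_or_eq_neg {u f u' f' : ℂ} {v v' : ℤ → ℂ} (h : IsMapOrbit u f v d)
    (h' : IsMapOrbit u' f' v' d) (hd : ∀ n : ℤ, 1 ≤ n → d n ≠ 0) (hu : u ≠ 0)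
    (hne : ∀ n : ℤ, 1 ≤ n → d n = d (n + 1) → d (n + 1) ≠ d (n + 2)) :
    ∃ ε : ℂ, (ε = 1 ∨ ε = -1) ∧ ∀ n : ℤ, 0 ≤ n → v' n = ε * v n := by
  have hsq : u' ^ 2 = u ^ 2 := by
    obtain ⟨n, hn, hdn⟩ : ∃ n : ℤ, 2 ≤ n ∧ d (n + 1) - d n ≠ 0 := by
      by_cases h2 : d 2 = d (2 + 1)
      · exact ⟨3, by norm_num, sub_ne_zero.mpr (hne 2 (by norm_num) h2).symm⟩
      · exact ⟨2, le_rfl, sub_ne_zero.mpr (Ne.symm h2)⟩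
    exact mul_right_cancel₀ hdn ((h'.sq_mul hd hn).trans (h.sq_mul hd hn).symm)
  obtain ⟨ε, hε, hε2, hue⟩ : ∃ ε : ℂ, (ε = 1 ∨ ε = -1) ∧ ε ^ 2 = 1 ∧ u' = ε * u := by
    rcases sq_eq_sq_iff_eq_or_eq_neg.mp hsq with e | e
    · exact ⟨1, .inl rfl, by norm_num, by rw [e, one_mul]⟩
    · exact ⟨-1, .inr rfl, by norm_num, by rw [e, neg_one_mul]⟩
  have hv : ∀ n : ℤ, 1 ≤ n → v' n = ε * v n := by
    intro n hn
    have e1 := (h.two_mul_mul hd (n := n + 1) (by omega)).2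
    have e2 := (h'.two_mul_mul hd (n := n + 1) (by omega)).2
    rw [add_sub_cancel_right] at e1 e2
    rw [hue] at e2
    apply mul_left_cancel₀ (mul_ne_zero (mul_ne_zero two_ne_zero hu) (hd (n + 1) (by omega)))
    linear_combination ε * e2 - ε * e1 + (u ^ 2 * ε - 2 * u * d (n + 1) * v' n) * hε2
  refine ⟨ε, hε, fun n hn => ?_⟩
  rcases hn.eq_or_lt with rfl | hn
  -- `two_mul_mul` does not reach v_0, which is recovered from v_1 by the first equation at index 1.
  · have e1 := h.mul_add hd le_rfl
    have e2 := h'.mul_add hd le_rfl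
    rw [hv 1 le_rfl, hue, ← e1, sub_self] at e2
    apply mul_left_cancel₀ (hd 1 le_rfl)
    linear_combination e2
  · exact hv n hn

theorem sum_Ico_succ (v : ℤ → ℂ) {n : ℤ} (hn : 0 ≤ n) :
    ∑ j ∈ Finset.Ico 0 (n + 1), v j = ∑ j ∈ Finset.Ico 0 n, v j + v n := by
  rw [← Finset.insert_Ico_right_eq_Ico_add_one hn, Finset.sum_insert (by simp), add_comm]

/-- Dividing a relation by x_n and taking differences in n shows that v is constant unless its
coefficient is 0. A constant v would make d_n · 2v_0 = u ≠ 0 for all n ≥ 1, hence d constant. -/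
theorem IsMapOrbit.linearIndependent {u f : ℂ} {v x : ℤ → ℂ} (h : IsMapOrbit u f v d)
    (hd : ∀ n : ℤ, 1 ≤ n → d n ≠ 0) (hu : u ≠ 0)
    (hne : ∀ n : ℤ, 1 ≤ n → d n = d (n + 1) → d (n + 1) ≠ d (n + 2))
    (hx : ∀ n : ℤ, 0 ≤ n → x n ≠ 0) :
    LinearIndependent ℂ
      ![fun n : ℕ => x n, fun n : ℕ => (n : ℂ) * x n, fun n : ℕ => thirdShadow x v n] := by
  rw [Fintype.linearIndependent_iff]
  intro g hg
  have hS : ∀ n : ℤ, 0 ≤ n → g 0 + g 1 * n - g 2 * ∑ j ∈ Finset.Ico 0 n, v j = 0 := by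
    intro n hn
    lift n to ℕ using hn
    have := congrFun hg n
    simp [Fin.sum_univ_three, thirdShadow] at this
    apply mul_left_cancel₀ (hx n (by positivity))
    push_cast
    linear_combination this
  have hv : ∀ n : ℤ, 0 ≤ n → g 1 = g 2 * v n := by
    intro n hn
    have e1 := hS n hn
    have e2 := hS (n + 1) (by omega)
    rw [sum_Ico_succ v hn] at e2
    push_cast at e2
    linear_combination e2 - e1
  have h2 : g 2 = 0 := by
    by_contra hg2
    have hv' : ∀ n : ℤ, 0 ≤ n → v n = v 0 := fun n hn =>
      mul_left_cancel₀ hg2 ((hv n hn).symm.trans (hv 0 le_rfl))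
    have e : ∀ n : ℤ, 1 ≤ n → d n * (2 * v 0) = u := fun n hn => by
      rw [← h.mul_add hd hn, hv' n (by omega), hv' (n - 1) (by omega), two_mul]
    have hv0 : 2 * v 0 ≠ 0 := fun h0 => hu (by rw [← e 1 le_rfl, h0, mul_zero])
    have hc : ∀ m n : ℤ, 1 ≤ m → 1 ≤ n → d m = d n := fun m n hm hn =>
      mul_right_cancel₀ hv0 ((e m hm).trans (e n hn).symm)
    exact hne 1 le_rfl (hc _ _ (by norm_num) (by norm_num)) (hc _ _ (by norm_num) (by norm_num))
  have h1 : g 1 = 0 := by rw [hv 0 le_rfl, h2, zero_mul]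
  have h0 : g 0 = 0 := by simpa using hS 0 le_rfl
  intro i
  fin_cases i <;> assumption

end Orbits

/-! ### The sequence x_n, its ratios, its orbit and its shadows. -/

section Sequence

variable (Λ : Submodule ℤ ℂ) [DiscreteTopology Λ] {A B z z₀ : ℂ}

/-- By (n+k)² + (n-k)² = 2n² + 2k² the gauge factors split into one depending only on n, which
cancels from homogeneous relations, and one depending only on k. -/
theorem somosSeq_mul (hB : B ≠ 0) (hz : z ∉ Λ) (n k : ℤ) :
    somosSeq Λ A B z z₀ (n + k) * somosSeq Λ A B z z₀ (n - k) =
      (A * B ^ n / sigma Λ z ^ (n ^ 2)) ^ 2 *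
        (sigma Λ (z₀ + n * z + k * z) * sigma Λ (z₀ + n * z - k * z) /
          (sigma Λ z ^ (k ^ 2)) ^ 2) := by
  have hs := sigma_ne_zero Λ hz
  have e1 : B ^ (n + k) * B ^ (n - k) = (B ^ n) ^ 2 := by
    rw [← zpow_add₀ hB, ← zpow_natCast, ← zpow_mul]; congr 1; push_cast; ring
  have e2 : sigma Λ z ^ ((n + k) ^ 2) * sigma Λ z ^ ((n - k) ^ 2) =
      (sigma Λ z ^ (n ^ 2)) ^ 2 * (sigma Λ z ^ (k ^ 2)) ^ 2 := by
    rw [← zpow_add₀ hs, ← zpow_natCast, ← zpow_natCast, ← zpow_mul, ← zpow_mul, ← zpow_add₀ hs]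
    congr 1; push_cast; ring
  have e3 : z₀ + ((n + k : ℤ) : ℂ) * z = z₀ + n * z + k * z := by push_cast; ring
  have e4 : z₀ + ((n - k : ℤ) : ℂ) * z = z₀ + n * z - k * z := by push_cast; ring
  rw [somosSeq, somosSeq, e3, e4, div_mul_div_comm, e2]
  calc _ = A ^ 2 * (B ^ (n + k) * B ^ (n - k)) *
        (sigma Λ (z₀ + n * z + k * z) * sigma Λ (z₀ + n * z - k * z)) /
        ((sigma Λ z ^ (n ^ 2)) ^ 2 * (sigma Λ z ^ (k ^ 2)) ^ 2) := by ring
    _ = _ := by rw [e1]; field_simp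

/-- The products of terms of the sequence placed symmetrically about the index `n + 2`. -/
theorem exists_somosSeq_products (hB : B ≠ 0) (hz : z ∉ Λ) (n : ℤ) :
    ∃ M : ℂ,
      somosSeq Λ A B z z₀ (n + 4) * somosSeq Λ A B z z₀ n =
        M * (sigma Λ (z₀ + (n + 2 : ℤ) * z + 2 * z) * sigma Λ (z₀ + (n + 2 : ℤ) * z - 2 * z) /
          sigma Λ z ^ 8) ∧
      somosSeq Λ A B z z₀ (n + 3) * somosSeq Λ A B z z₀ (n + 1) =
        M * (sigma Λ (z₀ + (n + 2 : ℤ) * z + z) * sigma Λ (z₀ + (n + 2 : ℤ) * z - z) /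
          sigma Λ z ^ 2) ∧
      somosSeq Λ A B z z₀ (n + 2) ^ 2 = M * sigma Λ (z₀ + (n + 2 : ℤ) * z) ^ 2 := by
  have h2 := somosSeq_mul Λ (A := A) (z₀ := z₀) hB hz (n + 2) 2
  have h1 := somosSeq_mul Λ (A := A) (z₀ := z₀) hB hz (n + 2) 1
  have h0 := somosSeq_mul Λ (A := A) (z₀ := z₀) hB hz (n + 2) 0
  refine ⟨(A * B ^ (n + 2) / sigma Λ z ^ ((n + 2) ^ 2)) ^ 2, Eq.trans ?_ (h2.trans ?_),
    Eq.trans ?_ (h1.trans ?_), Eq.trans ?_ (h0.trans ?_)⟩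
  · congr 2 <;> ring
  · norm_num [← pow_mul, zpow_ofNat]
  · congr 2 <;> ring
  · norm_num
  · simp [sq]
  · simp [sq]

theorem isSomos4_somosSeq (hB : B ≠ 0) (hz : 2 * z ∉ Λ) :
    IsSomos4 (coeffAlpha Λ z) (coeffBeta Λ z) (somosSeq Λ A B z z₀) := by
  intro n
  have hz' : z ∉ Λ := fun h => hz (by rw [two_mul]; exact Λ.add_mem h h)
  have hs := sigma_ne_zero Λ hz'
  obtain ⟨M, h2, h1, h0⟩ := exists_somosSeq_products Λ (A := A) (z₀ := z₀) hB hz' n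
  rw [h2, mul_assoc, h1, h0, coeffAlpha, coeffBeta]
  have := sigma_three_term Λ hz (z₀ + (n + 2 : ℤ) * z)
  generalize z₀ + ((n + 2 : ℤ) : ℂ) * z = w at *
  generalize sigma Λ (2 * z) = s₂, sigma Λ (3 * z) = s₃, sigma Λ (w + 2 * z) = t₁,
    sigma Λ (w - 2 * z) = t₂ at *
  field_simp
  linear_combination M * this

theorem somosSeq_ne_zero (hA : A ≠ 0) (hB : B ≠ 0) (hz : z ∉ Λ) {n : ℤ}
    (hn : z₀ + n * z ∉ Λ) : somosSeq Λ A B z z₀ n ≠ 0 :=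
  div_ne_zero (mul_ne_zero (mul_ne_zero hA (zpow_ne_zero _ hB)) (sigma_ne_zero Λ hn))
    (zpow_ne_zero _ (sigma_ne_zero Λ hz))

theorem ratio_somosSeq (hA : A ≠ 0) (hB : B ≠ 0) (hz : z ∉ Λ) {n : ℤ}
    (hn : z₀ + n * z ∉ Λ) :
    ratio (somosSeq Λ A B z z₀) n = deriv (zeta Λ) (z₀ + n * z) - deriv (zeta Λ) z := by
  have h1 := somosSeq_mul Λ (A := A) (z₀ := z₀) hB hz n 1
  have hs := sigma_ne_zero Λ hz
  have hw := sigma_ne_zero Λ hn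
  have hB' := zpow_ne_zero n hB
  have hs' := zpow_ne_zero (n ^ 2) hs
  rw [Int.cast_one, one_mul, sigma_add_mul_sigma_sub Λ hn hz] at h1
  rw [ratio, h1, somosSeq]
  simp only [one_pow, zpow_one]
  field_simp

/-- The orbit of the map that is given by the zeta function. -/
def zetaOrbit (z z₀ : ℂ) (n : ℤ) : ℂ :=
  zeta Λ (z₀ + (n + 1 : ℤ) * z) - zeta Λ (z₀ + n * z) - zeta Λ z

omit [DiscreteTopology Λ] in
theorem sum_zetaOrbit {n : ℤ} (hn : 0 ≤ n) :
    ∑ j ∈ Finset.Ico 0 n, zetaOrbit Λ z z₀ j =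
      zeta Λ (z₀ + n * z) - zeta Λ z₀ - n * zeta Λ z := by
  induction n, hn using Int.leInduction with
  | base => simp
  | succ n hn ih =>
    rw [sum_Ico_succ _ hn, ih, zetaOrbit]
    push_cast
    ring

theorem exists_isMapOrbit_zetaOrbit (hA : A ≠ 0) (hB : B ≠ 0) (hz : z ∉ Λ)
    (hx : ∀ n : ℤ, 0 ≤ n → z₀ + n * z ∉ Λ) :
    ∃ f : ℂ, IsMapOrbit (-deriv (deriv (zeta Λ)) z) f (zetaOrbit Λ z z₀)
      (ratio (somosSeq Λ A B z z₀)) := by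
  obtain ⟨C, hC⟩ := exists_zeta_sq Λ hz
  -- By `exists_zeta_sq`, v_n² = C - ζ'(w+z) - ζ'(w) at w = z₀+nz, while d_n + d_{n+1} = ζ'(w) +
  -- ζ'(w+z) - 2ζ'(z); this fixes f.
  refine ⟨2 * deriv (zeta Λ) z - C, fun n hn => ?_⟩
  have hw := hx n (by omega)
  have hw1 := hx (n + 1) (by omega)
  have hw2 := hx (n - 1) (by omega)
  have hx1 := somosSeq_ne_zero Λ hA hB hz hw1
  have hx2 := somosSeq_ne_zero Λ hA hB hz hw2
  have hd : ratio (somosSeq Λ A B z z₀) n ≠ 0 :=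
    div_ne_zero (mul_ne_zero hx1 hx2) (pow_ne_zero 2 (somosSeq_ne_zero Λ hA hB hz hw))
  have e1 : z₀ + ((n + 1 : ℤ) : ℂ) * z = z₀ + n * z + z := by push_cast; ring
  have e2 : z₀ + ((n - 1 : ℤ) : ℂ) * z = z₀ + n * z - z := by push_cast; ring
  rw [ratio_somosSeq Λ hA hB hz hw1, ratio_somosSeq Λ hA hB hz hw]
  rw [ratio_somosSeq Λ hA hB hz hw] at hd
  simp only [zetaOrbit, sub_add_cancel]
  rw [e1] at hw1 ⊢
  rw [e2] at hw2 ⊢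
  constructor
  · have h := zeta_add_add_zeta_sub Λ hz hw (by rwa [add_comm]) (by
      rw [← neg_sub]; exact mt Λ.neg_mem_iff.mp hw2)
    rw [← neg_sub (z₀ + n * z) z, zeta_neg, add_comm z] at h
    rw [eq_comm, neg_add_eq_iff_eq_add, div_eq_iff hd]
    linear_combination h
  · rw [hC _ hw hw1]
    ring

/-- Equal neighbours d_m = d_{m+1} mean equal values of ℘ at points differing by z ∉ Λ, so the sum
of the points lies in Λ. Two such sums for consecutive m differ by 2z ∉ Λ. -/
theorem ratio_somosSeq_not_constant (hA : A ≠ 0) (hB : B ≠ 0) (hz : 2 * z ∉ Λ)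
    (hx : ∀ n : ℤ, 0 ≤ n → z₀ + n * z ∉ Λ) {n : ℤ} (hn : 0 ≤ n)
    (h : ratio (somosSeq Λ A B z z₀) n = ratio (somosSeq Λ A B z z₀) (n + 1)) :
    ratio (somosSeq Λ A B z z₀) (n + 1) ≠ ratio (somosSeq Λ A B z z₀) (n + 2) := by
  have hz' : z ∉ Λ := fun h => hz (by rw [two_mul]; exact Λ.add_mem h h)
  have key : ∀ m : ℤ, 0 ≤ m →
      ratio (somosSeq Λ A B z z₀) m = ratio (somosSeq Λ A B z z₀) (m + 1) →
      2 * z₀ + (2 * m + 1) * z ∈ Λ := by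
    intro m hm he
    have h1 := hx m hm
    have h2 := hx (m + 1) (by omega)
    rw [ratio_somosSeq Λ hA hB hz' h1, ratio_somosSeq Λ hA hB hz' h2, sub_left_inj] at he
    rcases mem_of_deriv_zeta_eq Λ h1 h2 he with h3 | h3
    · convert! h3 using 1
      push_cast; ring
    · refine absurd (Λ.neg_mem h3) ?_
      convert! hz' using 2
      push_cast; ring
  intro h'
  refine hz ?_
  have := Λ.sub_mem (key (n + 1) (by omega) (by rw [h', add_assoc]; rfl)) (key n hn h)
  convert! this using 1
  push_cast; ring

/-- These are the infinitesimal variations of A, B and z₀. For y_n = x_n c_n the equation weights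
the three Somos-4 products by c_n + c_{n+4}, c_{n+1} + c_{n+3} and 2c_{n+2}; for affine c the
weights coincide, and for c_n = ζ(z₀+nz) it becomes `sigma_three_term_deriv`. -/
theorem isShadow_of_eq_zeta (hB : B ≠ 0) (hz : 2 * z ∉ Λ)
    (hx : ∀ n : ℤ, 0 ≤ n → z₀ + n * z ∉ Λ) {y : ℤ → ℂ} {a b c : ℂ}
    (hy : ∀ n : ℤ, 0 ≤ n →
      y n = somosSeq Λ A B z z₀ n * (a + b * n + c * zeta Λ (z₀ + n * z))) :
    IsShadow (coeffAlpha Λ z) (coeffBeta Λ z) (somosSeq Λ A B z z₀) y := by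
  intro n hn
  have hz' : z ∉ Λ := fun h => hz (by rw [two_mul]; exact Λ.add_mem h h)
  have hs := sigma_ne_zero Λ hz'
  obtain ⟨M, h2, h1, h0⟩ := exists_somosSeq_products Λ (A := A) (z₀ := z₀) hB hz' n
  have hS := isSomos4_somosSeq Λ (A := A) (z₀ := z₀) hB hz n
  have m0 := hx n hn
  have m1 := hx (n + 1) (by omega)
  have m2 := hx (n + 2) (by omega)
  have m3 := hx (n + 3) (by omega)
  have m4 := hx (n + 4) (by omega)
  rw [hy n hn, hy (n + 1) (by omega), hy (n + 2) (by omega), hy (n + 3) (by omega),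
    hy (n + 4) (by omega)]
  have e0 : z₀ + (n : ℂ) * z = z₀ + ((n + 2 : ℤ) : ℂ) * z - 2 * z := by push_cast; ring
  have e1 : z₀ + ((n + 1 : ℤ) : ℂ) * z = z₀ + ((n + 2 : ℤ) : ℂ) * z - z := by push_cast; ring
  have e3 : z₀ + ((n + 3 : ℤ) : ℂ) * z = z₀ + ((n + 2 : ℤ) : ℂ) * z + z := by push_cast; ring
  have e4 : z₀ + ((n + 4 : ℤ) : ℂ) * z = z₀ + ((n + 2 : ℤ) : ℂ) * z + 2 * z := by
    push_cast; ring
  rw [e0] at m0 ⊢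
  rw [e1] at m1 ⊢
  rw [e3] at m3 ⊢
  rw [e4] at m4 ⊢
  have hD := sigma_three_term_deriv Λ hz m2 m3 m1 m4 m0
  push_cast at *
  generalize z₀ + ((n : ℂ) + 2) * z = w at *
  have hK : somosSeq Λ A B z z₀ (n + 4) * somosSeq Λ A B z z₀ n *
        (zeta Λ (w + 2 * z) + zeta Λ (w - 2 * z)) =
      coeffAlpha Λ z * (somosSeq Λ A B z z₀ (n + 3) * somosSeq Λ A B z z₀ (n + 1)) *
        (zeta Λ (w + z) + zeta Λ (w - z)) +
      coeffBeta Λ z * somosSeq Λ A B z z₀ (n + 2) ^ 2 * (2 * zeta Λ w) := by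
    rw [h2, h1, h0, coeffAlpha, coeffBeta]
    generalize sigma Λ (2 * z) = s₂, sigma Λ (3 * z) = s₃, sigma Λ (w + 2 * z) = t₁,
      sigma Λ (w - 2 * z) = t₂, zeta Λ (w + 2 * z) = r₁, zeta Λ (w - 2 * z) = r₂ at *
    field_simp
    linear_combination M * hD
  linear_combination (2 * a + b * (2 * n + 4)) * hS + c * hK

end Sequence

end SomosShadow

end

theorem mainTheorem7 (Λ : Submodule ℤ ℂ) [DiscreteTopology Λ] (A B z z₀ : ℂ)
    (hA : A ≠ 0) (hB : B ≠ 0) (hz : 2 * z ∉ Λ) (hx : ∀ n : ℕ, z₀ + n * z ∉ Λ) :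
    let x : ℤ → ℂ := SomosShadow.somosSeq Λ A B z z₀
    let α : ℂ := SomosShadow.coeffAlpha Λ z
    let β : ℂ := SomosShadow.coeffBeta Λ z
    let d : ℤ → ℂ := SomosShadow.ratio x
    SomosShadow.IsSomos4 α β x ∧
    (∃ (u f : ℂ) (v : ℤ → ℂ), SomosShadow.IsMapOrbit u f v d) ∧
    ∀ (u f : ℂ) (v : ℤ → ℂ), SomosShadow.IsMapOrbit u f v d →
      SomosShadow.IsShadow α β x (SomosShadow.thirdShadow x v) ∧
      LinearIndependent ℂ
        ![fun n : ℕ => x n, fun n : ℕ => (n : ℂ) * x n,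
          fun n : ℕ => SomosShadow.thirdShadow x v n] ∧
      ∃ ε : ℂ, (ε = 1 ∨ ε = -1) ∧ ∀ n : ℕ,
        SomosShadow.thirdShadow x v n =
          ε * (n * SomosShadow.zeta Λ z * x n + SomosShadow.zeta Λ z₀ * x n
            - x n * SomosShadow.zeta Λ (z₀ + n * z)) := by
  intro x α β d
  have hz' : z ∉ Λ := fun h => hz (by rw [two_mul]; exact Λ.add_mem h h)
  have hxi : ∀ n : ℤ, 0 ≤ n → z₀ + n * z ∉ Λ := by
    intro n hn
    lift n to ℕ using hn
    simpa using hx n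
  have hx0 : ∀ n : ℤ, 0 ≤ n → x n ≠ 0 := fun n hn =>
    SomosShadow.somosSeq_ne_zero Λ hA hB hz' (hxi n hn)
  have hd : ∀ n : ℤ, 1 ≤ n → d n ≠ 0 := fun n hn =>
    div_ne_zero (mul_ne_zero (hx0 _ (by omega)) (hx0 _ (by omega)))
      (pow_ne_zero 2 (hx0 _ (by omega)))
  have hne : ∀ n : ℤ, 1 ≤ n → d n = d (n + 1) → d (n + 1) ≠ d (n + 2) := fun n hn h =>
    SomosShadow.ratio_somosSeq_not_constant Λ hA hB hz hxi (by omega) h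
  have hu : -deriv (deriv (SomosShadow.zeta Λ)) z ≠ 0 :=
    neg_ne_zero.mpr (SomosShadow.deriv_deriv_zeta_ne_zero Λ hz)
  obtain ⟨f₀, h₀⟩ := SomosShadow.exists_isMapOrbit_zetaOrbit Λ hA hB hz' hxi
  refine ⟨SomosShadow.isSomos4_somosSeq Λ hB hz, ⟨_, _, _, h₀⟩, fun u f v h => ?_⟩
  obtain ⟨ε, hε, hv⟩ := h₀.eq_or_eq_neg h hd hu hne
  have hy : ∀ n : ℤ, 0 ≤ n → SomosShadow.thirdShadow x v n =
      x n * (ε * SomosShadow.zeta Λ z₀ + ε * SomosShadow.zeta Λ z * n +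
        -ε * SomosShadow.zeta Λ (z₀ + n * z)) := by
    intro n hn
    rw [SomosShadow.thirdShadow, Finset.sum_congr rfl fun j hj => hv j (Finset.mem_Ico.mp hj).1,
      ← Finset.mul_sum, SomosShadow.sum_zetaOrbit Λ hn]
    ring
  -- The sign relation between the orbits transfers to u through d_1(v_1 + v_0) = u, so u is plus or
  -- minus the nonzero value -ζ''(z).
  have hu' : u ≠ 0 := by
    intro h0
    have e1 := h₀.mul_add hd le_rfl
    have e2 := h.mul_add hd le_rfl
    rw [hv 1 (by norm_num), hv (1 - 1) (by norm_num), h0] at e2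
    apply hu
    rw [← e1]
    rcases hε with rfl | rfl
    · linear_combination e2
    · linear_combination -e2
  refine ⟨SomosShadow.isShadow_of_eq_zeta Λ hB hz hxi hy, h.linearIndependent hd hu' hne hx0,
    ε, hε, fun n => ?_⟩
  rw [hy n (by positivity)]
  push_cast
  ring
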